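/- Let $A_0,A_1,b_0,b_1$ be non-negative integers, not all zero, and let $(f(n))_{n\ge 1}$ be a sequence of non-negative integers, not identically zero, with $$f(2n)=A_0f(n)+b_0,\qquad f(2n+1)=A_1f(n)+b_1\qquad (n\ge 1),$$ where the initial value $f(1)$ is arbitrary. On the torus $\mathbb{T}=\mathbb{R}/\mathbb{Z}$, with normalised Lebesgue measure $\lambda$, put $$\mu_N=\frac{1}{\Sigma(N)}\sum_{n=0}^{2^N-1} f(2^N+n)\,\delta_{n/2^N},\qquad \Sigma(N)=\sum_{n=0}^{2^N-1}f(2^N+n)$$ ($\Sigma(N)>0$ for all $N\ge 1$). Then the ghost measure $\mu$ of $f$ exists: there is exactly one finite Borel measure $\mu$ on $\mathbb{T}$ with $\int g\,d\mu_N\to\int g\,d\mu$ for every continuous $g:\mathbb{T}\to\mathbb{R}$. It is a probability measure, and its Lebesgue type is as follows. 1. Suppose $b_0=b_1=0$. (A) If $A_0=A_1\ne 0$, then $\mu=\lambda$. (B) If $A_0\ne A_1$ and neither is $0$, then $\mu$ is singular continuous. (C) If $A_0=0$ or $A_1=0$, then $\mu$ is pure point, and $\mu=\delta_0$. 2. Suppose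 $b_0+b_1\ne 0$. (A) If $A_0+A_1\le 2$, then $\mu=\lambda$. (B) If $A_0=A_1>1$, then $\mu$ is absolutely continuous. (C) If $A_0\ne A_1$ and neither is $0$, then $\mu$ is singular continuous. (D) If one of $A_0,A_1$ is $0$ and the other is greater than $2$, then $\mu$ is pure point. Here a finite Borel measure on $\mathbb{T}$ is called pure point if it is a countable sum of weighted Dirac measures, absolutely continuous if it is of the form $g\,\lambda$ with $0\le g\in L^1(\mathbb{T})$, and singular continuous if it has no atoms and is concentrated on a set of Lebesgue measure zero. -/

import Mathlib

open MeasureTheory Filter Topology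
open scoped ENNReal

/-- `f` is an affine `2`-regular sequence with coefficients `A₀, A₁, b₀, b₁`.  The sequence starts
at `f 1`, which is a free initial value; the relations are not imposed at `n = 0`, where they may
be inconsistent. -/
def IsAffineTwoRegular (A₀ A₁ b₀ b₁ : ℕ) (f : ℕ → ℕ) : Prop :=
  ∀ n : ℕ, 1 ≤ n → f (2 * n) = A₀ * f n + b₀ ∧ f (2 * n + 1) = A₁ * f n + b₁

/-- The sum of `f` over the fundamental region `[2 ^ N, 2 ^ (N + 1))`. -/
def levelSum (f : ℕ → ℕ) (N : ℕ) : ℕ :=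
  ∑ n ∈ Finset.range (2 ^ N), f (2 ^ N + n)

/-- The `N`-th approximant to the ghost measure: the Dirac comb on the torus with weight
`f (2 ^ N + n)` at the point `n / 2 ^ N`, divided by its total mass.
(It is the zero measure if that total mass vanishes.) -/
noncomputable def ghostApprox (f : ℕ → ℕ) (N : ℕ) : Measure UnitAddCircle :=
  (levelSum f N : ℝ≥0∞)⁻¹ •
    ∑ n ∈ Finset.range (2 ^ N),
      (f (2 ^ N + n) : ℝ≥0∞) • Measure.dirac (((n : ℝ) / 2 ^ N : ℝ) : UnitAddCircle)

/-- The finite Borel measure `μ` on the torus is the vague limit of the measures `ν N`. -/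
def IsVagueLimit (ν : ℕ → Measure UnitAddCircle) (μ : Measure UnitAddCircle) : Prop :=
  IsFiniteMeasure μ ∧
    ∀ g : UnitAddCircle → ℝ, Continuous g →
      Tendsto (fun N => ∫ x, g x ∂(ν N)) atTop (𝓝 (∫ x, g x ∂μ))

/-- `μ` is the ghost measure of `f`. -/
def IsGhostMeasure (f : ℕ → ℕ) (μ : Measure UnitAddCircle) : Prop :=
  IsVagueLimit (ghostApprox f) μ

/-- Pure point: a countable sum of weighted Dirac measures (weights may be zero, so that finite
sums are included). -/
def IsPurePoint (μ : Measure UnitAddCircle) : Prop :=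
  ∃ (c : ℕ → ℝ≥0∞) (x : ℕ → UnitAddCircle), μ = Measure.sum fun i => c i • Measure.dirac (x i)

/-- Singular continuous: no point has positive mass, and the measure is concentrated on a set of
Lebesgue measure zero. -/
def IsSingularContinuous (μ : Measure UnitAddCircle) : Prop :=
  (∀ x : UnitAddCircle, μ {x} = 0) ∧ μ ⟂ₘ (volume : Measure UnitAddCircle)

/-- Absolutely continuous: there is an integrable density with respect to Lebesgue measure. -/
def IsAbsContinuous (μ : Measure UnitAddCircle) : Prop :=
  ∃ g : UnitAddCircle → ℝ, Integrable g volume ∧ (∀ x, 0 ≤ g x) ∧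
    μ = (volume : Measure UnitAddCircle).withDensity fun x => ENNReal.ofReal (g x)

/-!
Let `A = A₀ + A₁`, let `s m j` be the sum of `f` over the `2 ^ j` descendants at depth `j` of the
node `m` of the binary tree with edges from `m` to `2 m` and `2 m + 1`. The recursion gives
`s m (j + 1) = A * s m j + 2 ^ j * (b₀ + b₁)`, so that `s m j / s 1 j` converges, say to `w m`. Any
measure built from a consistent family of measures with masses `w m` at the nodes `m` is the limit
of the combs, because a continuous function is almost constant on small dyadic intervals.

If `b₀ + b₁ ≠ 0` and `A ≤ 2`, the source term dominates, `w` is constant and the limit is Lebesgue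
measure. Otherwise let `β` be the law of a random number with independent binary digits equal to
`0` and `1` with probabilities `A₀ / A` and `A₁ / A`. The family `f m • β + S`, where `S` collects
the copies of `β` emitted by the constants `b₀, b₁` further down the tree, has masses proportional
to `w m`, and hence the ghost measure has the same Lebesgue type as `β`: Lebesgue measure if
`A₀ = A₁`, a Dirac mass at an end point if `A₀ = 0` or `A₁ = 0`, and otherwise an atomless measure
which is singular by the strong law of large numbers for the digits.
-/

/-! ### Dyadic decompositions of measures on the unit interval -/

theorem sum_range_mul {M : Type*} [AddCommMonoid M] (a b : ℕ) (F : ℕ → M) :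
    ∑ x ∈ Finset.range (a * b), F x =
      ∑ i ∈ Finset.range a, ∑ n ∈ Finset.range b, F (i * b + n) := by
  induction a with
  | zero => simp
  | succ a ih => rw [Nat.succ_mul, Finset.sum_range_add, ih, Finset.sum_range_succ]

/-- The affine contraction of the unit interval onto the `n`-th dyadic interval of level `k`. -/
noncomputable def dyadicBranch (k n : ℕ) (x : ℝ) : ℝ := (x + n) / 2 ^ k

theorem dyadicBranch_zero_zero : dyadicBranch 0 0 = id := by
  ext x
  simp [dyadicBranch]

theorem continuous_dyadicBranch (k n : ℕ) : Continuous (dyadicBranch k n) := by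
  unfold dyadicBranch
  fun_prop

theorem measurableEmbedding_dyadicBranch (k n : ℕ) : MeasurableEmbedding (dyadicBranch k n) :=
  (continuous_dyadicBranch k n).measurableEmbedding fun x y h => by
    simpa [dyadicBranch, div_left_inj' (pow_ne_zero k (two_ne_zero' ℝ))] using h

theorem measurable_dyadicBranch (k n : ℕ) : Measurable (dyadicBranch k n) :=
  (measurableEmbedding_dyadicBranch k n).measurable

theorem dyadicBranch_mem_Icc {k n : ℕ} (hn : n < 2 ^ k) {x : ℝ} (hx : x ∈ Set.Icc (0 : ℝ) 1) :
    dyadicBranch k n x ∈ Set.Icc (0 : ℝ) 1 := by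
  have hn' : (n : ℝ) + 1 ≤ 2 ^ k := by exact_mod_cast hn
  have hx0 := hx.1
  refine ⟨by unfold dyadicBranch; positivity, ?_⟩
  rw [dyadicBranch, div_le_one (by positivity)]
  linarith [hx.2]

theorem dyadicBranch_comp (k n l d : ℕ) :
    dyadicBranch k n ∘ dyadicBranch l d = dyadicBranch (k + l) (n * 2 ^ l + d) := by
  ext x
  simp only [Function.comp, dyadicBranch]
  push_cast
  field_simp
  ring

theorem map_dyadicBranch_compl_Icc {ν : Measure ℝ} (hν : ν (Set.Icc 0 1)ᶜ = 0) {k n : ℕ}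
    (hn : n < 2 ^ k) : ν.map (dyadicBranch k n) (Set.Icc 0 1)ᶜ = 0 := by
  rw [Measure.map_apply (measurable_dyadicBranch k n) measurableSet_Icc.compl]
  exact measure_mono_null (fun x hx hx' => hx (dyadicBranch_mem_Icc hn hx')) hν

theorem exists_oscillation_dyadicBranch_le {h : ℝ → ℝ} (hc : Continuous h) {ε : ℝ} (hε : 0 < ε) :
    ∃ k : ℕ, ∀ i < 2 ^ k, ∀ x ∈ Set.Icc (0 : ℝ) 1,
      |h (dyadicBranch k i x) - h (dyadicBranch k i 0)| ≤ ε := by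
  obtain ⟨δ, hδ, hosc⟩ := Metric.uniformContinuousOn_iff.1
    ((isCompact_Icc (a := (0 : ℝ)) (b := 1)).uniformContinuousOn_of_continuous hc.continuousOn) ε hε
  obtain ⟨k, hk⟩ := exists_pow_lt_of_lt_one hδ (by norm_num : (1 / 2 : ℝ) < 1)
  refine ⟨k, fun i hi x hx =>
    (hosc _ (dyadicBranch_mem_Icc hi hx) _ (dyadicBranch_mem_Icc hi (by simp)) ?_).le⟩
  have hdiff : dyadicBranch k i x - dyadicBranch k i 0 = x * (1 / 2) ^ k := by
    simp only [dyadicBranch, one_div, inv_pow]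
    ring
  rw [Real.dist_eq, hdiff, abs_of_nonneg (mul_nonneg hx.1 (by positivity))]
  exact (mul_le_of_le_one_left (by positivity) hx.2).trans_lt hk

/-- `μ` splits over the dyadic intervals of level `k`, and its part on the `i`-th of them, rescaled
to the unit interval, is the finite measure `ν i`. -/
structure IsDyadicDecomposition (k : ℕ) (μ : Measure ℝ) (ν : ℕ → Measure ℝ) : Prop where
  finite : ∀ i, IsFiniteMeasure (ν i)
  compl_Icc : ∀ i, ν i (Set.Icc 0 1)ᶜ = 0
  eq_sum : μ = ∑ i ∈ Finset.range (2 ^ k), (ν i).map (dyadicBranch k i)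

namespace IsDyadicDecomposition

variable {k : ℕ} {μ : Measure ℝ} {ν : ℕ → Measure ℝ}

theorem real_univ (hμ : IsDyadicDecomposition k μ ν) :
    μ.real Set.univ = ∑ i ∈ Finset.range (2 ^ k), (ν i).real Set.univ := by
  have := hμ.finite
  simp only [measureReal_def]
  rw [hμ.eq_sum, Measure.finsetSum_apply, ENNReal.toReal_sum fun i _ => measure_ne_top _ _]
  simp only [Measure.map_apply (measurable_dyadicBranch _ _) MeasurableSet.univ, Set.preimage_univ]

theorem integral_eq (hμ : IsDyadicDecomposition k μ ν) (h : BoundedContinuousFunction ℝ ℝ) :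
    ∫ x, h x ∂μ = ∑ i ∈ Finset.range (2 ^ k), ∫ x, h (dyadicBranch k i x) ∂ν i := by
  have := hμ.finite
  rw [hμ.eq_sum, integral_finsetSum_measure fun i _ => h.integrable _]
  exact Finset.sum_congr rfl fun i _ => (measurableEmbedding_dyadicBranch k i).integral_map _

theorem abs_integral_sub_sum_le (hμ : IsDyadicDecomposition k μ ν)
    (h : BoundedContinuousFunction ℝ ℝ) {ε : ℝ}
    (hε : ∀ i < 2 ^ k, ∀ x ∈ Set.Icc (0 : ℝ) 1,
      |h (dyadicBranch k i x) - h (dyadicBranch k i 0)| ≤ ε) :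
    |∫ x, h x ∂μ - ∑ i ∈ Finset.range (2 ^ k), (ν i).real Set.univ * h (dyadicBranch k i 0)| ≤
      ε * μ.real Set.univ := by
  have := hμ.finite
  rw [hμ.integral_eq h, hμ.real_univ, ← Finset.sum_sub_distrib, Finset.mul_sum]
  refine (Finset.abs_sum_le_sum_abs _ _).trans (Finset.sum_le_sum fun i hi => ?_)
  have hint : Integrable (fun x => h (dyadicBranch k i x)) (ν i) :=
    (h.compContinuous ⟨_, continuous_dyadicBranch k i⟩).integrable _
  rw [← smul_eq_mul, ← integral_const, ← integral_sub hint (integrable_const _),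
    ← Real.norm_eq_abs]
  refine norm_integral_le_of_norm_le_const ?_
  have hIcc : ∀ᵐ x ∂ν i, x ∈ Set.Icc (0 : ℝ) 1 := hμ.compl_Icc i
  filter_upwards [hIcc] with x hx using hε i (Finset.mem_range.1 hi) x hx

end IsDyadicDecomposition

theorem tendsto_integral_of_isDyadicDecomposition {ι : Type*} {l : Filter ι} {μ : ι → Measure ℝ}
    {ν : ℕ → ι → ℕ → Measure ℝ} {μ' : Measure ℝ} {ν' : ℕ → ℕ → Measure ℝ}
    (hμ : ∀ k, ∀ᶠ a in l, IsDyadicDecomposition k (μ a) (ν k a))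
    (hμ' : ∀ k, IsDyadicDecomposition k μ' (ν' k))
    (hmass : ∀ k, ∀ i < 2 ^ k,
      Tendsto (fun a => (ν k a i).real Set.univ) l (𝓝 ((ν' k i).real Set.univ)))
    (h : BoundedContinuousFunction ℝ ℝ) :
    Tendsto (fun a => ∫ x, h x ∂μ a) l (𝓝 (∫ x, h x ∂μ')) := by
  set W := μ'.real Set.univ with hW
  have hW0 : 0 ≤ W := measureReal_nonneg
  refine Metric.tendsto_nhds.2 fun ε hε => ?_
  set e := ε / (2 * W + 2) with he
  have he0 : 0 < e := by positivity
  obtain ⟨k, hk⟩ := exists_oscillation_dyadicBranch_le h.continuous he0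
  have htotal : Tendsto (fun a => ∑ i ∈ Finset.range (2 ^ k), (ν k a i).real Set.univ) l (𝓝 W) := by
    rw [hW, (hμ' k).real_univ]
    exact tendsto_finsetSum _ fun i hi => hmass k i (Finset.mem_range.1 hi)
  have hsum : Tendsto
      (fun a => ∑ i ∈ Finset.range (2 ^ k), (ν k a i).real Set.univ * h (dyadicBranch k i 0)) l
      (𝓝 (∑ i ∈ Finset.range (2 ^ k), (ν' k i).real Set.univ * h (dyadicBranch k i 0))) :=
    tendsto_finsetSum _ fun i hi => (hmass k i (Finset.mem_range.1 hi)).mul_const _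
  have hlim := (hμ' k).abs_integral_sub_sum_le h hk
  filter_upwards [hμ k, htotal.eventually_lt_const (lt_add_one W),
    Metric.tendsto_nhds.1 hsum e he0] with a ha hWa hSa
  have happrox := ha.abs_integral_sub_sum_le h hk
  rw [ha.real_univ] at happrox
  have hεe : ε = e * (W + 1) + e + e * W := by rw [he]; field_simp; ring
  have hmul : e * ∑ i ∈ Finset.range (2 ^ k), (ν k a i).real Set.univ < e * (W + 1) := by gcongr
  rw [Real.dist_eq] at hSa ⊢
  rw [abs_le] at hlim happrox
  rw [abs_lt] at hSa ⊢
  constructor <;> linarith [hlim.1, hlim.2, happrox.1, happrox.2, hSa.1, hSa.2]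

/-- A family of finite measures on the unit interval, indexed by the nodes `m ≥ 1` of the binary
tree, each of which is up to a factor `α` assembled from the measures at the two children. -/
structure IsDyadicFamily (α : ℝ≥0∞) (M : ℕ → Measure ℝ) : Prop where
  ne_top : α ≠ ∞
  finite : ∀ m, IsFiniteMeasure (M m)
  compl_Icc : ∀ m, M m (Set.Icc 0 1)ᶜ = 0
  split : ∀ m, 1 ≤ m → M m = α • ((M (2 * m)).map (dyadicBranch 1 0) +
    (M (2 * m + 1)).map (dyadicBranch 1 1))

namespace IsDyadicFamily

variable {α : ℝ≥0∞} {M M' : ℕ → Measure ℝ}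

theorem eq_sum (hM : IsDyadicFamily α M) (k : ℕ) :
    M 1 = α ^ k • ∑ i ∈ Finset.range (2 ^ k), (M (2 ^ k + i)).map (dyadicBranch k i) := by
  induction k with
  | zero => simp [dyadicBranch_zero_zero]
  | succ k ih =>
    rw [ih, pow_succ 2 k, sum_range_mul, pow_succ α, mul_smul, Finset.smul_sum (r := α)]
    congr 1
    refine Finset.sum_congr rfl fun i _ => ?_
    rw [hM.split _ (Nat.one_le_two_pow.trans (Nat.le_add_right _ _)), Measure.map_smul,
      Measure.map_add _ _ (measurable_dyadicBranch _ _),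
      Measure.map_map (measurable_dyadicBranch _ _) (measurable_dyadicBranch _ _),
      Measure.map_map (measurable_dyadicBranch _ _) (measurable_dyadicBranch _ _),
      dyadicBranch_comp, dyadicBranch_comp]
    simp only [Finset.sum_range_succ, Finset.sum_range_zero, zero_add, pow_one, add_zero]
    ring_nf

theorem isDyadicDecomposition (hM : IsDyadicFamily α M) (k : ℕ) :
    IsDyadicDecomposition k (M 1) fun i => α ^ k • M (2 ^ k + i) where
  finite i :=
    have := hM.finite (2 ^ k + i)
    Measure.smul_finite _ (ENNReal.pow_ne_top hM.ne_top)
  compl_Icc i := by simp [hM.compl_Icc]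
  eq_sum := by simp only [Measure.map_smul, ← Finset.smul_sum, ← hM.eq_sum k]

theorem ext (hM : IsDyadicFamily α M) (hM' : IsDyadicFamily α M')
    (h : ∀ m, M m Set.univ = M' m Set.univ) : M 1 = M' 1 := by
  have := hM.finite
  have := hM'.finite
  refine ext_of_forall_integral_eq_of_IsFiniteMeasure fun g => tendsto_nhds_unique
    (tendsto_const_nhds (f := (atTop : Filter ℕ)))
    (tendsto_integral_of_isDyadicDecomposition
      (fun k => .of_forall fun _ => hM.isDyadicDecomposition k) hM'.isDyadicDecomposition
      (fun k i _ => ?_) g)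
  simp only [measureReal_def, Measure.smul_apply, h]
  exact tendsto_const_nhds

theorem smul (hM : IsDyadicFamily α M) {c : ℝ≥0∞} (hc : c ≠ ∞) :
    IsDyadicFamily α fun m => c • M m where
  ne_top := hM.ne_top
  finite m := have := hM.finite m; Measure.smul_finite _ hc
  compl_Icc m := by simp [hM.compl_Icc]
  split m hm := by
    rw [Measure.map_smul, Measure.map_smul, ← smul_add, smul_comm α c, ← hM.split m hm]

end IsDyadicFamily

/-! ### Dirac combs and the existence of the ghost measure -/

/-- The sum of `f` over the descendants at depth `j` of the node `m` of the binary tree. -/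
def descendantSum (f : ℕ → ℕ) (j m : ℕ) : ℕ :=
  ∑ n ∈ Finset.range (2 ^ j), f (2 ^ j * m + n)

/-- The comb of the values of `f` at the descendants at depth `j` of the node `m` of the binary
tree, spread over the unit interval. -/
noncomputable def descendantComb (f : ℕ → ℕ) (j m : ℕ) : Measure ℝ :=
  ∑ n ∈ Finset.range (2 ^ j), (f (2 ^ j * m + n) : ℝ≥0∞) • Measure.dirac ((n : ℝ) / 2 ^ j)

theorem levelSum_eq_descendantSum (f : ℕ → ℕ) (N : ℕ) : levelSum f N = descendantSum f N 1 := by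
  simp [levelSum, descendantSum]

theorem levelSum_add (f : ℕ → ℕ) (k j : ℕ) :
    levelSum f (k + j) = ∑ i ∈ Finset.range (2 ^ k), descendantSum f j (2 ^ k + i) := by
  rw [levelSum, pow_add, sum_range_mul]
  refine Finset.sum_congr rfl fun i _ => Finset.sum_congr rfl fun n _ => ?_
  ring_nf

theorem descendantComb_univ (f : ℕ → ℕ) (j m : ℕ) :
    descendantComb f j m Set.univ = descendantSum f j m := by
  simp [descendantComb, descendantSum, Measure.finsetSum_apply]

theorem descendantComb_compl_Icc (f : ℕ → ℕ) (j m : ℕ) :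
    descendantComb f j m (Set.Icc 0 1)ᶜ = 0 := by
  rw [descendantComb, Measure.finsetSum_apply]
  refine Finset.sum_eq_zero fun n hn => ?_
  have hn' : (n : ℝ) ≤ 2 ^ j := by exact_mod_cast (Finset.mem_range.1 hn).le
  have hmem : (n : ℝ) / 2 ^ j ∈ Set.Icc (0 : ℝ) 1 :=
    ⟨by positivity, div_le_one_of_le₀ hn' (by positivity)⟩
  rw [Measure.smul_apply, Measure.dirac_apply' _ measurableSet_Icc.compl,
    Set.indicator_of_notMem (Set.notMem_compl_iff.2 hmem), smul_zero]

theorem descendantComb_add_one (f : ℕ → ℕ) (k j : ℕ) :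
    descendantComb f (k + j) 1 = ∑ i ∈ Finset.range (2 ^ k),
      (descendantComb f j (2 ^ k + i)).map (dyadicBranch k i) := by
  rw [descendantComb, pow_add, sum_range_mul]
  refine Finset.sum_congr rfl fun i _ => ?_
  rw [descendantComb, Measure.map_finset_sum (measurable_dyadicBranch k i).aemeasurable]
  refine Finset.sum_congr rfl fun n _ => ?_
  rw [Measure.map_smul, Measure.map_dirac' (measurable_dyadicBranch k i)]
  congr 2
  · ring_nf
  · simp only [dyadicBranch, Nat.cast_add, Nat.cast_mul, Nat.cast_pow, Nat.cast_ofNat, pow_add]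
    field_simp
    ring

theorem ghostApprox_eq_map (f : ℕ → ℕ) (N : ℕ) :
    ghostApprox f N =
      ((levelSum f N : ℝ≥0∞)⁻¹ • descendantComb f N 1).map ((↑) : ℝ → UnitAddCircle) := by
  have hmk : Measurable ((↑) : ℝ → UnitAddCircle) := AddCircle.measurable_mk'
  rw [ghostApprox, descendantComb, Measure.map_smul, Measure.map_finset_sum hmk.aemeasurable]
  simp only [Measure.map_smul, Measure.map_dirac' hmk, mul_one]

theorem isDyadicDecomposition_descendantComb {f : ℕ → ℕ} {k N : ℕ} (hkN : k ≤ N)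
    (hN : levelSum f N ≠ 0) :
    IsDyadicDecomposition k ((levelSum f N : ℝ≥0∞)⁻¹ • descendantComb f N 1) fun i =>
      (levelSum f N : ℝ≥0∞)⁻¹ • descendantComb f (N - k) (2 ^ k + i) where
  finite i := ⟨by
    rw [Measure.smul_apply, descendantComb_univ]
    exact ENNReal.mul_lt_top (by simpa [pos_iff_ne_zero] using hN) (ENNReal.natCast_lt_top _)⟩
  compl_Icc i := by simp [descendantComb_compl_Icc]
  eq_sum := by
    obtain ⟨j, rfl⟩ := Nat.exists_eq_add_of_le hkN
    simp only [descendantComb_add_one, Nat.add_sub_cancel_left, Measure.map_smul, Finset.smul_sum]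

theorem tendsto_descendantSum_div_levelSum_add {w : ℕ → ℝ} {f : ℕ → ℕ}
    (hw : ∀ m, 1 ≤ m → Tendsto (fun j => (descendantSum f j m : ℝ) / levelSum f j) atTop (𝓝 (w m)))
    {m k : ℕ} (hm : 1 ≤ m) (hk : ∑ i ∈ Finset.range (2 ^ k), w (2 ^ k + i) ≠ 0) :
    Tendsto (fun j => (descendantSum f j m : ℝ) / levelSum f (k + j)) atTop
      (𝓝 (w m / ∑ i ∈ Finset.range (2 ^ k), w (2 ^ k + i))) := by
  have hratio : Tendsto (fun j => (levelSum f (k + j) : ℝ) / levelSum f j) atTop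
      (𝓝 (∑ i ∈ Finset.range (2 ^ k), w (2 ^ k + i))) := by
    simp only [levelSum_add, Nat.cast_sum, Finset.sum_div]
    exact tendsto_finsetSum _ fun i _ => hw _ (Nat.one_le_two_pow.trans (Nat.le_add_right _ _))
  refine ((hw m hm).div hratio hk).congr' ?_
  filter_upwards [hratio.eventually_ne hk] with j hj
  exact div_div_div_cancel_right₀ (div_ne_zero_iff.1 hj).2 _ _

theorem IsDyadicFamily.isGhostMeasure {α : ℝ≥0∞} {M : ℕ → Measure ℝ} (hM : IsDyadicFamily α M)
    [IsProbabilityMeasure (M 1)] {f : ℕ → ℕ} (hw : ∀ m, 1 ≤ m →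
      Tendsto (fun j => (descendantSum f j m : ℝ) / levelSum f j) atTop
        (𝓝 ((M m).real Set.univ))) :
    IsGhostMeasure f ((M 1).map ((↑) : ℝ → UnitAddCircle)) := by
  have hmk : Continuous ((↑) : ℝ → UnitAddCircle) := AddCircle.continuous_mk' 1
  refine ⟨inferInstance, fun g hg => ?_⟩
  simp only [ghostApprox_eq_map, integral_map hmk.measurable.aemeasurable hg.aestronglyMeasurable]
  have hlevel : ∀ᶠ N in atTop, levelSum f N ≠ 0 := by
    filter_upwards [(hw 1 le_rfl).eventually_ne (b₂ := 0) (by simp)] with N hN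
    exact_mod_cast (div_ne_zero_iff.1 hN).2
  refine tendsto_integral_of_isDyadicDecomposition
    (fun k => ((eventually_ge_atTop k).and hlevel).mono fun N hN =>
      isDyadicDecomposition_descendantComb hN.1 hN.2) hM.isDyadicDecomposition (fun k i _ => ?_)
    ((BoundedContinuousFunction.mkOfCompact ⟨g, hg⟩).compContinuous ⟨_, hmk⟩)
  have hmass : (α ^ k).toReal * ∑ i ∈ Finset.range (2 ^ k), (M (2 ^ k + i)).real Set.univ = 1 := by
    have := (hM.isDyadicDecomposition k).real_univ
    simp only [measureReal_ennreal_smul_apply, ← Finset.mul_sum, probReal_univ] at this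
    exact this.symm
  have hpart := tendsto_descendantSum_div_levelSum_add hw (m := 2 ^ k + i) (k := k)
    (Nat.one_le_two_pow.trans (Nat.le_add_right _ _)) (right_ne_zero_of_mul_eq_one hmass)
  rw [div_eq_mul_inv, ← eq_inv_of_mul_eq_one_left hmass, mul_comm] at hpart
  refine (tendsto_add_atTop_iff_nat k).1 ?_
  simpa only [measureReal_def, Measure.smul_apply, smul_eq_mul, descendantComb_univ,
    ENNReal.toReal_mul, ENNReal.toReal_inv, ENNReal.toReal_natCast, Nat.add_sub_cancel,
    add_comm k, div_eq_inv_mul] using hpart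

theorem IsGhostMeasure.unique {f : ℕ → ℕ} {μ ν : Measure UnitAddCircle} (hμ : IsGhostMeasure f μ)
    (hν : IsGhostMeasure f ν) : ν = μ := by
  have := hμ.1
  have := hν.1
  exact ext_of_forall_integral_eq_of_IsFiniteMeasure fun g =>
    tendsto_nhds_unique (hν.2 g g.continuous) (hμ.2 g g.continuous)

/-! ### Growth of the level sums -/

namespace IsAffineTwoRegular

variable {A₀ A₁ b₀ b₁ : ℕ} {f : ℕ → ℕ}

theorem descendantSum_succ (hf : IsAffineTwoRegular A₀ A₁ b₀ b₁ f) {m : ℕ} (hm : 1 ≤ m) (j : ℕ) :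
    descendantSum f (j + 1) m = (A₀ + A₁) * descendantSum f j m + 2 ^ j * (b₀ + b₁) := by
  have hchildren : ∀ i, f (2 ^ (j + 1) * m + (i * 2 + 0)) + f (2 ^ (j + 1) * m + (i * 2 + 1)) =
      (A₀ + A₁) * f (2 ^ j * m + i) + (b₀ + b₁) := fun i => by
    obtain ⟨heven, hodd⟩ := hf (2 ^ j * m + i) (le_add_right (Nat.mul_pos (by positivity) hm))
    rw [show 2 ^ (j + 1) * m + (i * 2 + 0) = 2 * (2 ^ j * m + i) by ring,
      show 2 ^ (j + 1) * m + (i * 2 + 1) = 2 * (2 ^ j * m + i) + 1 by ring, heven, hodd]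
    ring
  rw [descendantSum, show Finset.range (2 ^ (j + 1)) = Finset.range (2 ^ j * 2) by rw [pow_succ],
    sum_range_mul]
  simp only [Finset.sum_range_succ, Finset.sum_range_zero, zero_add, hchildren]
  rw [Finset.sum_add_distrib, ← Finset.mul_sum, Finset.sum_const, Finset.card_range, smul_eq_mul,
    descendantSum]

theorem descendantSum_add_two_pow_mul (hf : IsAffineTwoRegular A₀ A₁ b₀ b₁ f) {s : ℝ}
    (hs : (A₀ + A₁) * s = b₀ + b₁ + 2 * s) {m : ℕ} (hm : 1 ≤ m) (j : ℕ) :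
    descendantSum f j m + 2 ^ j * s = (A₀ + A₁ : ℝ) ^ j * (f m + s) := by
  induction j with
  | zero => simp [descendantSum]
  | succ j ih =>
    rw [hf.descendantSum_succ hm, pow_succ' (A₀ + A₁ : ℝ), mul_assoc, ← ih]
    push_cast
    linear_combination -2 ^ j * hs

theorem tendsto_descendantSum_div_pow (hf : IsAffineTwoRegular A₀ A₁ b₀ b₁ f) {s : ℝ}
    (hs : (A₀ + A₁) * s = b₀ + b₁ + 2 * s) (hA : 0 < A₀ + A₁) (hsA : s = 0 ∨ 2 < A₀ + A₁) {m : ℕ}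
    (hm : 1 ≤ m) :
    Tendsto (fun j => (descendantSum f j m : ℝ) / (A₀ + A₁) ^ j) atTop (𝓝 (f m + s)) := by
  have hA0 : (0 : ℝ) < A₀ + A₁ := by exact_mod_cast hA
  have heq : ∀ j, (descendantSum f j m : ℝ) / (A₀ + A₁) ^ j =
      f m + s - (2 / (A₀ + A₁)) ^ j * s := fun j => by
    rw [eq_sub_of_add_eq (hf.descendantSum_add_two_pow_mul hs hm j), div_pow]
    field_simp
  have hcorr : Tendsto (fun j => (2 / (A₀ + A₁ : ℝ)) ^ j * s) atTop (𝓝 0) := by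
    rcases hsA with rfl | hA2
    · simp only [mul_zero, tendsto_const_nhds]
    · have hA2' : (2 : ℝ) < A₀ + A₁ := by exact_mod_cast hA2
      simpa only [zero_mul] using (tendsto_pow_atTop_nhds_zero_of_lt_one (by positivity)
        ((div_lt_one hA0).2 hA2')).mul_const s
  simpa only [heq, sub_zero] using hcorr.const_sub (f m + s)

theorem tendsto_descendantSum_div_levelSum (hf : IsAffineTwoRegular A₀ A₁ b₀ b₁ f) {s : ℝ}
    (hs : (A₀ + A₁) * s = b₀ + b₁ + 2 * s) (hA : 0 < A₀ + A₁) (hsA : s = 0 ∨ 2 < A₀ + A₁)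
    (hroot : f 1 + s ≠ 0) {m : ℕ} (hm : 1 ≤ m) :
    Tendsto (fun j => (descendantSum f j m : ℝ) / levelSum f j) atTop
      (𝓝 ((f m + s) / (f 1 + s))) := by
  refine ((hf.tendsto_descendantSum_div_pow hs hA hsA hm).div
    (hf.tendsto_descendantSum_div_pow hs hA hsA le_rfl) hroot).congr fun j => ?_
  have hA0 : (0 : ℝ) < A₀ + A₁ := by exact_mod_cast hA
  rw [Pi.div_apply, div_div_div_cancel_right₀ (pow_ne_zero j hA0.ne'), levelSum_eq_descendantSum]

theorem descendantSum_sub_levelSum (hf : IsAffineTwoRegular A₀ A₁ b₀ b₁ f) {m : ℕ} (hm : 1 ≤ m)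
    (j : ℕ) :
    (descendantSum f j m : ℝ) - levelSum f j = (A₀ + A₁) ^ j * (f m - f 1) := by
  rw [levelSum_eq_descendantSum]
  induction j with
  | zero => simp [descendantSum]
  | succ j ih =>
    rw [hf.descendantSum_succ hm, hf.descendantSum_succ le_rfl, pow_succ', mul_assoc, ← ih]
    push_cast
    ring

theorem mul_pow_le_mul_levelSum (hf : IsAffineTwoRegular A₀ A₁ b₀ b₁ f) (hb : b₀ + b₁ ≠ 0)
    (hA : A₀ + A₁ ≤ 2) (j : ℕ) : j * (A₀ + A₁) ^ j ≤ (A₀ + A₁) * levelSum f j := by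
  rw [levelSum_eq_descendantSum]
  induction j with
  | zero => simp
  | succ j ih =>
    have hpow : (A₀ + A₁) ^ j ≤ 2 ^ j * (b₀ + b₁) :=
      (Nat.pow_le_pow_left hA j).trans (Nat.le_mul_of_pos_right _ (Nat.pos_of_ne_zero hb))
    calc (j + 1) * (A₀ + A₁) ^ (j + 1) = (A₀ + A₁) * (j * (A₀ + A₁) ^ j + (A₀ + A₁) ^ j) := by ring
      _ ≤ (A₀ + A₁) * ((A₀ + A₁) * descendantSum f j 1 + 2 ^ j * (b₀ + b₁)) := by gcongr
      _ = (A₀ + A₁) * descendantSum f (j + 1) 1 := by rw [hf.descendantSum_succ le_rfl]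

theorem levelSum_succ_pos (hf : IsAffineTwoRegular A₀ A₁ b₀ b₁ f) (hb : b₀ + b₁ ≠ 0) (j : ℕ) :
    0 < levelSum f (j + 1) := by
  rw [levelSum_eq_descendantSum, hf.descendantSum_succ le_rfl]
  positivity

theorem tendsto_descendantSum_div_levelSum_one (hf : IsAffineTwoRegular A₀ A₁ b₀ b₁ f)
    (hb : b₀ + b₁ ≠ 0) (hA : A₀ + A₁ ≤ 2) {m : ℕ} (hm : 1 ≤ m) :
    Tendsto (fun j => (descendantSum f j m : ℝ) / levelSum f j) atTop (𝓝 1) := by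
  refine (tendsto_add_atTop_iff_nat 1).1 ?_
  have hpos : ∀ j, (0 : ℝ) < levelSum f (j + 1) := fun j => by
    exact_mod_cast hf.levelSum_succ_pos hb j
  have hsmall : Tendsto (fun j => (A₀ + A₁ : ℝ) ^ (j + 1) / levelSum f (j + 1)) atTop (𝓝 0) := by
    refine squeeze_zero (fun j => by positivity) (fun j => ?_)
      ((tendsto_add_atTop_iff_nat 1).2 (tendsto_const_div_atTop_nhds_zero_nat (A₀ + A₁ : ℝ)))
    rw [div_le_div_iff₀ (hpos j) (by positivity), mul_comm]
    exact_mod_cast hf.mul_pow_le_mul_levelSum hb hA (j + 1)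
  have hone := (hsmall.mul_const ((f m : ℝ) - f 1)).const_add 1
  rw [zero_mul, add_zero] at hone
  refine hone.congr fun j => ?_
  rw [div_mul_eq_mul_div, ← hf.descendantSum_sub_levelSum hm, sub_div, div_self (hpos j).ne']
  ring

theorem eq_zero_of_apply_one_eq_zero (hf : IsAffineTwoRegular A₀ A₁ 0 0 f) (h1 : f 1 = 0) {n : ℕ}
    (hn : 1 ≤ n) : f n = 0 := by
  induction n using Nat.strong_induction_on with
  | _ n ih =>
    obtain ⟨k, rfl | rfl⟩ := Nat.even_or_odd' n
    · rw [(hf k (by omega)).1, ih k (by omega) (by omega), mul_zero, add_zero]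
    · rcases k.eq_zero_or_pos with rfl | hk
      · exact h1
      · rw [(hf k hk).2, ih k (by omega) hk, mul_zero, add_zero]

end IsAffineTwoRegular

/-! ### Self-similar measures and the measures of the nodes -/

/-- The copies of `ν` on the two halves of the unit interval, with weights `p` and `q`. -/
noncomputable def bisect (p q : ℝ≥0∞) (ν : Measure ℝ) : Measure ℝ :=
  p • ν.map (dyadicBranch 1 0) + q • ν.map (dyadicBranch 1 1)

theorem bisect_apply (p q : ℝ≥0∞) (ν : Measure ℝ) {s : Set ℝ} (hs : MeasurableSet s) :
    bisect p q ν s = p * ν (dyadicBranch 1 0 ⁻¹' s) + q * ν (dyadicBranch 1 1 ⁻¹' s) := by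
  simp [bisect, Measure.map_apply (measurable_dyadicBranch _ _) hs]

theorem bisect_univ (p q : ℝ≥0∞) (ν : Measure ℝ) :
    bisect p q ν Set.univ = (p + q) * ν Set.univ := by
  rw [bisect_apply _ _ _ MeasurableSet.univ, Set.preimage_univ, Set.preimage_univ, add_mul]

theorem bisect_absolutelyContinuous {ρ ν : Measure ℝ}
    (hρ : ∀ d < 2, ρ.map (dyadicBranch 1 d) ≪ ρ) (hν : ν ≪ ρ) (p q : ℝ≥0∞) : bisect p q ν ≪ ρ :=
  .add_left_iff.2 ⟨((hν.map (measurable_dyadicBranch _ _)).trans (hρ 0 two_pos)).smul_left p,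
    ((hν.map (measurable_dyadicBranch _ _)).trans (hρ 1 one_lt_two)).smul_left q⟩

/-- A probability measure on the unit interval that is stationary for the random dyadic
contraction choosing the left half with probability `p` and the right half with probability `q`. -/
structure IsBinarySelfSimilar (p q : ℝ≥0∞) (β : Measure ℝ) : Prop where
  isProbabilityMeasure : IsProbabilityMeasure β
  compl_Icc : β (Set.Icc 0 1)ᶜ = 0
  bisect_eq : bisect p q β = β

namespace IsBinarySelfSimilar

variable {p q α : ℝ≥0∞} {β : Measure ℝ}

theorem add_eq_one (hβ : IsBinarySelfSimilar p q β) : p + q = 1 := by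
  have := hβ.isProbabilityMeasure
  simpa [hβ.bisect_eq] using (bisect_univ p q β).symm

theorem isDyadicFamily_const (hβ : IsBinarySelfSimilar α α β) : IsDyadicFamily α fun _ => β where
  ne_top := by
    rintro rfl
    simpa using hβ.add_eq_one
  finite _ := have := hβ.isProbabilityMeasure; inferInstance
  compl_Icc _ := hβ.compl_Icc
  split _ _ := by
    rw [smul_add]
    exact hβ.bisect_eq.symm

end IsBinarySelfSimilar

/-- The solution of `S = bisect p q β + bisect α α S` obtained by iteration. -/
noncomputable def sourceSum (α p q : ℝ≥0∞) (β : Measure ℝ) : Measure ℝ :=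
  Measure.sum fun j => (bisect α α)^[j] (bisect p q β)

section SourceSum

variable {α p q : ℝ≥0∞} {β : Measure ℝ}

theorem sourceSum_eq_add (α p q : ℝ≥0∞) (β : Measure ℝ) :
    sourceSum α p q β = bisect p q β + bisect α α (sourceSum α p q β) := by
  ext s hs
  have hs' : ∀ d, MeasurableSet (dyadicBranch 1 d ⁻¹' s) := fun d => measurable_dyadicBranch _ _ hs
  rw [Measure.add_apply, bisect_apply α α _ hs, sourceSum, Measure.sum_apply _ hs,
    Measure.sum_apply _ (hs' 0), Measure.sum_apply _ (hs' 1), tsum_eq_zero_add' ENNReal.summable,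
    ← ENNReal.tsum_mul_left, ← ENNReal.tsum_mul_left, ← ENNReal.tsum_add]
  simp only [Function.iterate_succ_apply', bisect_apply α α _ hs, Function.iterate_zero, id]

theorem sourceSum_univ (α p q : ℝ≥0∞) (β : Measure ℝ) :
    sourceSum α p q β Set.univ = (1 - 2 * α)⁻¹ * ((p + q) * β Set.univ) := by
  have hiter : ∀ j, (bisect α α)^[j] (bisect p q β) Set.univ =
      (2 * α) ^ j * ((p + q) * β Set.univ) := fun j => by
    induction j with
    | zero => simp [bisect_univ]
    | succ j ih => rw [Function.iterate_succ_apply', bisect_univ, ih, ← two_mul, pow_succ']; ring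
  simp only [sourceSum, Measure.sum_apply _ MeasurableSet.univ, hiter, ENNReal.tsum_mul_right,
    ENNReal.tsum_geometric]

theorem sourceSum_zero (α : ℝ≥0∞) (β : Measure ℝ) : sourceSum α 0 0 β = 0 := by
  rw [← Measure.measure_univ_eq_zero, sourceSum_univ, add_zero, zero_mul, mul_zero]

theorem sourceSum_univ_lt_top [IsFiniteMeasure β] (hp : p ≠ ∞) (hq : q ≠ ∞) (hα : 2 * α < 1) :
    sourceSum α p q β Set.univ < ∞ := by
  rw [sourceSum_univ]
  exact ENNReal.mul_lt_top (ENNReal.inv_lt_top.2 (tsub_pos_of_lt hα))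
    (ENNReal.mul_lt_top (ENNReal.add_lt_top.2 ⟨hp.lt_top, hq.lt_top⟩) (measure_lt_top β _))

theorem sourceSum_absolutelyContinuous {ρ : Measure ℝ}
    (hρ : ∀ d < 2, ρ.map (dyadicBranch 1 d) ≪ ρ) (hβ : β ≪ ρ) : sourceSum α p q β ≪ ρ := by
  refine Measure.absolutelyContinuous_sum_left fun j => ?_
  induction j with
  | zero => exact bisect_absolutelyContinuous hρ hβ p q
  | succ j ih =>
    rw [Function.iterate_succ_apply']
    exact bisect_absolutelyContinuous hρ ih α α

end SourceSum

/-- The measure attached to the node `m` of the binary tree of an affine `2`-regular sequence `f`: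
`β` carries the value `f m`, and the sources carry the constants `b₀, b₁` injected below `m`. -/
noncomputable def nodeMeasure (α : ℝ≥0∞) (b₀ b₁ : ℕ) (f : ℕ → ℕ) (β : Measure ℝ) (m : ℕ) :
    Measure ℝ :=
  (f m : ℝ≥0∞) • β + sourceSum α (α * b₀) (α * b₁) β

/-- The normalised measure of the root of the binary tree, projected to the torus. -/
noncomputable def torusRootMeasure (α : ℝ≥0∞) (b₀ b₁ : ℕ) (f : ℕ → ℕ) (β : Measure ℝ) :
    Measure UnitAddCircle :=
  ((nodeMeasure α b₀ b₁ f β 1 Set.univ)⁻¹ • nodeMeasure α b₀ b₁ f β 1).map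
    ((↑) : ℝ → UnitAddCircle)

theorem nodeMeasure_absolutelyContinuous {α : ℝ≥0∞} {b₀ b₁ : ℕ} {f : ℕ → ℕ} {β ρ : Measure ℝ}
    (hρ : ∀ d < 2, ρ.map (dyadicBranch 1 d) ≪ ρ) (hβ : β ≪ ρ) (m : ℕ) :
    nodeMeasure α b₀ b₁ f β m ≪ ρ :=
  .add_left_iff.2 ⟨hβ.smul_left _, sourceSum_absolutelyContinuous hρ hβ⟩

theorem torusRootMeasure_absolutelyContinuous {α : ℝ≥0∞} {b₀ b₁ : ℕ} {f : ℕ → ℕ} {β ρ : Measure ℝ}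
    (hρ : ∀ d < 2, ρ.map (dyadicBranch 1 d) ≪ ρ) (hβ : β ≪ ρ) :
    torusRootMeasure α b₀ b₁ f β ≪ ρ.map ((↑) : ℝ → UnitAddCircle) :=
  ((nodeMeasure_absolutelyContinuous hρ hβ 1).smul_left _).map AddCircle.measurable_mk'

theorem torusRootMeasure_of_homogeneous {α : ℝ≥0∞} {f : ℕ → ℕ} (hf : f 1 ≠ 0) {β : Measure ℝ}
    [IsProbabilityMeasure β] :
    torusRootMeasure α 0 0 f β = β.map ((↑) : ℝ → UnitAddCircle) := by
  have hf' : (f 1 : ℝ≥0∞) ≠ 0 := by exact_mod_cast hf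
  simp [torusRootMeasure, nodeMeasure, sourceSum_zero, smul_smul,
    ENNReal.inv_mul_cancel hf' (ENNReal.natCast_ne_top _)]

/-- The sum of the copies of `ν` on all dyadic intervals. It dominates every measure that arises
from `ν` by repeated bisection, so that null sets of the latter can be found copy by copy. -/
noncomputable def dyadicCopies (ν : Measure ℝ) : Measure ℝ :=
  Measure.sum fun w : Σ k, Fin (2 ^ k) => ν.map (dyadicBranch w.1 w.2)

theorem absolutelyContinuous_dyadicCopies (ν : Measure ℝ) : ν ≪ dyadicCopies ν := by
  refine Measure.absolutelyContinuous_sum_right (⟨0, 0⟩ : Σ k, Fin (2 ^ k)) ?_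
  simp [dyadicBranch_zero_zero, Measure.AbsolutelyContinuous.rfl]

theorem map_dyadicCopies_absolutelyContinuous (ν : Measure ℝ) {d : ℕ} (hd : d < 2) :
    (dyadicCopies ν).map (dyadicBranch 1 d) ≪ dyadicCopies ν := by
  rw [dyadicCopies, Measure.map_sum (measurable_dyadicBranch 1 d).aemeasurable]
  refine Measure.absolutelyContinuous_sum_left fun w => ?_
  have hlt : d * 2 ^ w.1 + w.2 < 2 ^ (1 + w.1) := by
    have := w.2.isLt
    rw [pow_add]
    nlinarith
  refine Measure.absolutelyContinuous_sum_right
    (⟨1 + w.1, d * 2 ^ w.1 + w.2, hlt⟩ : Σ k, Fin (2 ^ k)) ?_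
  rw [Measure.map_map (measurable_dyadicBranch _ _) (measurable_dyadicBranch _ _),
    dyadicBranch_comp]

theorem dyadicCopies_compl_Icc {ν : Measure ℝ} (hν : ν (Set.Icc 0 1)ᶜ = 0) :
    dyadicCopies ν (Set.Icc 0 1)ᶜ = 0 := by
  rw [dyadicCopies, Measure.sum_apply_eq_zero]
  exact fun w => map_dyadicBranch_compl_Icc hν w.2.isLt

namespace IsBinarySelfSimilar

variable {A₀ A₁ b₀ b₁ : ℕ} {α : ℝ≥0∞} {β : Measure ℝ}

theorem add_pos (hβ : IsBinarySelfSimilar (α * A₀) (α * A₁) β) : 0 < A₀ + A₁ := by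
  by_contra! h
  obtain ⟨rfl, rfl⟩ : A₀ = 0 ∧ A₁ = 0 := by omega
  simpa using hβ.add_eq_one

theorem eq_inv (hβ : IsBinarySelfSimilar (α * A₀) (α * A₁) β) :
    α = ((A₀ + A₁ : ℕ) : ℝ≥0∞)⁻¹ :=
  ENNReal.eq_inv_of_mul_eq_one_left (by rw [Nat.cast_add, mul_add, hβ.add_eq_one])

theorem scale_ne_top (hβ : IsBinarySelfSimilar (α * A₀) (α * A₁) β) : α ≠ ∞ := by
  rw [hβ.eq_inv, ENNReal.inv_ne_top]
  exact_mod_cast hβ.add_pos.ne'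

theorem sourceSum_lt_top (hβ : IsBinarySelfSimilar (α * A₀) (α * A₁) β)
    (hbA : b₀ + b₁ = 0 ∨ 2 < A₀ + A₁) : sourceSum α (α * b₀) (α * b₁) β Set.univ < ∞ := by
  have := hβ.isProbabilityMeasure
  have hα := hβ.scale_ne_top
  rcases hbA with hb | hA
  · obtain ⟨rfl, rfl⟩ := Nat.add_eq_zero_iff.1 hb
    simp [sourceSum_zero]
  · refine sourceSum_univ_lt_top (by finiteness) (by finiteness) ?_
    rw [hβ.eq_inv, ← div_eq_mul_inv]
    exact ENNReal.div_lt_of_lt_mul (by rw [one_mul]; exact_mod_cast hA)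

theorem mul_sourceSum_real_univ (hβ : IsBinarySelfSimilar (α * A₀) (α * A₁) β)
    (hfin : sourceSum α (α * b₀) (α * b₁) β Set.univ < ∞) :
    (A₀ + A₁) * (sourceSum α (α * b₀) (α * b₁) β).real Set.univ =
      b₀ + b₁ + 2 * (sourceSum α (α * b₀) (α * b₁) β).real Set.univ := by
  have := hβ.isProbabilityMeasure
  set S := sourceSum α (α * b₀) (α * b₁) β with hS
  have hα : α * (A₀ + A₁) = 1 := by rw [mul_add, hβ.add_eq_one]
  have hmass : S Set.univ = α * (b₀ + b₁ + 2 * S Set.univ) := by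
    conv_lhs => rw [hS, sourceSum_eq_add, ← hS, Measure.add_apply, bisect_univ, bisect_univ,
      measure_univ]
    ring
  have hmul : (A₀ + A₁) * S Set.univ = b₀ + b₁ + 2 * S Set.univ := by
    conv_lhs => rw [hmass, ← mul_assoc, mul_comm (A₀ + A₁ : ℝ≥0∞), hα, one_mul]
  have hreal := congrArg ENNReal.toReal hmul
  rw [ENNReal.toReal_add (by finiteness) (by finiteness)] at hreal
  simpa [ENNReal.toReal_add, measureReal_def] using hreal

end IsBinarySelfSimilar

namespace IsAffineTwoRegular

variable {A₀ A₁ b₀ b₁ : ℕ} {f : ℕ → ℕ} {α : ℝ≥0∞} {β : Measure ℝ}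

theorem isDyadicFamily_nodeMeasure (hf : IsAffineTwoRegular A₀ A₁ b₀ b₁ f)
    (hβ : IsBinarySelfSimilar (α * A₀) (α * A₁) β)
    (hfin : sourceSum α (α * b₀) (α * b₁) β Set.univ < ∞) :
    IsDyadicFamily α (nodeMeasure α b₀ b₁ f β) where
  ne_top := hβ.scale_ne_top
  finite m := ⟨by
    have := hβ.isProbabilityMeasure
    simp [nodeMeasure, hfin]⟩
  compl_Icc m := nodeMeasure_absolutelyContinuous
    (fun _ => map_dyadicCopies_absolutelyContinuous β) (absolutelyContinuous_dyadicCopies β) m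
    (dyadicCopies_compl_Icc hβ.compl_Icc)
  split m hm := by
    obtain ⟨heven, hodd⟩ := hf m hm
    ext s hs
    have hsource := congrArg (· s) (sourceSum_eq_add α (α * b₀) (α * b₁) β)
    have hself := congrArg (· s) hβ.bisect_eq
    simp only [Measure.add_apply, bisect_apply _ _ _ hs] at hsource hself
    simp only [nodeMeasure, Measure.add_apply, Measure.smul_apply, smul_eq_mul,
      Measure.map_apply (measurable_dyadicBranch _ _) hs, heven, hodd, Nat.cast_add, Nat.cast_mul]
    rw [hsource, ← hself]
    ring

theorem isGhostMeasure_torusRootMeasure (hf : IsAffineTwoRegular A₀ A₁ b₀ b₁ f)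
    (hβ : IsBinarySelfSimilar (α * A₀) (α * A₁) β) (hbA : b₀ + b₁ = 0 ∨ 2 < A₀ + A₁)
    (hne : f 1 ≠ 0 ∨ b₀ + b₁ ≠ 0) :
    IsGhostMeasure f (torusRootMeasure α b₀ b₁ f β) ∧
      IsProbabilityMeasure (torusRootMeasure α b₀ b₁ f β) := by
  have := hβ.isProbabilityMeasure
  have hfin := hβ.sourceSum_lt_top hbA
  have hfam := hf.isDyadicFamily_nodeMeasure hβ hfin
  have hfinite := hfam.finite
  have hs := hβ.mul_sourceSum_real_univ hfin
  set s := (sourceSum α (α * b₀) (α * b₁) β).real Set.univ with hs_def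
  have hs0 : 0 ≤ s := measureReal_nonneg
  have hmass : ∀ m, (nodeMeasure α b₀ b₁ f β m).real Set.univ = f m + s := fun m => by
    simp [nodeMeasure, measureReal_def, ENNReal.toReal_add, hfin.ne, s]
  have hroot : (f 1 + s : ℝ) ≠ 0 := fun h => by
    obtain ⟨hf1, hs1⟩ := (add_eq_zero_iff_of_nonneg (Nat.cast_nonneg _) hs0).1 h
    rw [hs1, mul_zero, mul_zero, add_zero] at hs
    exact hne.elim (· (by exact_mod_cast hf1)) (· (by exact_mod_cast hs.symm))
  have hsA : s = 0 ∨ 2 < A₀ + A₁ := hbA.imp_left fun hb => by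
    obtain ⟨rfl, rfl⟩ := Nat.add_eq_zero_iff.1 hb
    simp [hs_def, sourceSum_zero]
  have : NeZero (nodeMeasure α b₀ b₁ f β 1) := ⟨fun h => hroot (by rw [← hmass, h]; simp)⟩
  have hprob : IsProbabilityMeasure
      ((nodeMeasure α b₀ b₁ f β 1 Set.univ)⁻¹ • nodeMeasure α b₀ b₁ f β 1) := inferInstance
  refine ⟨(hfam.smul (ENNReal.inv_ne_top.2 (NeZero.ne _))).isGhostMeasure fun m hm => ?_,
    Measure.isProbabilityMeasure_map (AddCircle.measurable_mk').aemeasurable⟩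
  rw [measureReal_ennreal_smul_apply, ENNReal.toReal_inv, ← measureReal_def, hmass, hmass,
    ← div_eq_inv_mul]
  exact hf.tendsto_descendantSum_div_levelSum hs hβ.add_pos hsA hroot hm

end IsAffineTwoRegular

/-! ### Lebesgue measure on the unit interval -/

theorem map_dyadicBranch_volume (k n : ℕ) :
    (volume : Measure ℝ).map (dyadicBranch k n) = (2 : ℝ≥0∞) ^ k • volume := by
  have hcomp : dyadicBranch k n = (fun x : ℝ => x * (2 ^ k)⁻¹) ∘ fun x : ℝ => x + n := by
    ext x
    simp [dyadicBranch, div_eq_mul_inv]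
  rw [hcomp, ← Measure.map_map (by fun_prop) (by fun_prop), map_add_right_eq_self,
    Real.map_volume_mul_right (by positivity), inv_inv, abs_of_pos (by positivity),
    ENNReal.ofReal_pow zero_le_two, ENNReal.ofReal_ofNat]

/-- Lebesgue measure on the unit interval, as a measure on the real line. The half-open interval is
the fundamental domain on which the projection to the torus is injective. -/
noncomputable def unitLebesgue : Measure ℝ := volume.restrict (Set.Ioc 0 1)

instance : IsProbabilityMeasure unitLebesgue := ⟨by simp [unitLebesgue]⟩

theorem unitLebesgue_compl_Ioc : unitLebesgue (Set.Ioc 0 1)ᶜ = 0 :=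
  Measure.restrict_apply_eq_zero' measurableSet_Ioc |>.2 (by simp)

theorem map_dyadicBranch_unitLebesgue (k n : ℕ) :
    unitLebesgue.map (dyadicBranch k n) =
      (2 : ℝ≥0∞) ^ k • volume.restrict (Set.Ioc (n / 2 ^ k : ℝ) ((n + 1) / 2 ^ k)) := by
  have hpre : dyadicBranch k n ⁻¹' Set.Ioc (n / 2 ^ k : ℝ) ((n + 1) / 2 ^ k) = Set.Ioc 0 1 := by
    ext x
    simp only [Set.mem_preimage, dyadicBranch, Set.mem_Ioc]
    rw [div_lt_div_iff_of_pos_right (by positivity), div_le_div_iff_of_pos_right (by positivity)]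
    constructor <;> rintro ⟨h0, h1⟩ <;> constructor <;> linarith
  rw [unitLebesgue, ← hpre, ← Measure.restrict_map (measurable_dyadicBranch k n) measurableSet_Ioc,
    map_dyadicBranch_volume, Measure.restrict_smul]

theorem isBinarySelfSimilar_unitLebesgue : IsBinarySelfSimilar 2⁻¹ 2⁻¹ unitLebesgue where
  isProbabilityMeasure := inferInstance
  compl_Icc := measure_mono_null (Set.compl_subset_compl.2 Set.Ioc_subset_Icc_self)
    unitLebesgue_compl_Ioc
  bisect_eq := by
    rw [bisect, map_dyadicBranch_unitLebesgue, map_dyadicBranch_unitLebesgue, ← smul_add,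
      ← smul_add, smul_smul, pow_one, ENNReal.inv_mul_cancel two_ne_zero ENNReal.ofNat_ne_top,
      one_smul, ← Measure.restrict_union (by simp) measurableSet_Ioc]
    norm_num [unitLebesgue]

theorem map_dyadicBranch_unitLebesgue_absolutelyContinuous {d : ℕ} (hd : d < 2) :
    unitLebesgue.map (dyadicBranch 1 d) ≪ unitLebesgue := by
  rw [map_dyadicBranch_unitLebesgue]
  refine (Measure.absolutelyContinuous_of_le (Measure.restrict_mono ?_ le_rfl)).smul_left _
  exact Set.Ioc_subset_Ioc (by positivity) (by interval_cases d <;> norm_num)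

theorem map_coe_unitLebesgue : unitLebesgue.map ((↑) : ℝ → UnitAddCircle) = volume := by
  simpa [unitLebesgue] using (AddCircle.measurePreserving_mk (1 : ℝ) 0).map_eq

theorem IsAffineTwoRegular.isGhostMeasure_volume {A₀ A₁ b₀ b₁ : ℕ} {f : ℕ → ℕ}
    (hf : IsAffineTwoRegular A₀ A₁ b₀ b₁ f) (hb : b₀ + b₁ ≠ 0) (hA : A₀ + A₁ ≤ 2) :
    IsGhostMeasure f volume := by
  rw [← map_coe_unitLebesgue]
  refine isBinarySelfSimilar_unitLebesgue.isDyadicFamily_const.isGhostMeasure fun m hm => ?_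
  simpa using hf.tendsto_descendantSum_div_levelSum_one hb hA hm

/-! ### Lebesgue types -/

theorem mutuallySingular_map_of_injOn {X Y : Type*} [MeasurableSpace X] [StandardBorelSpace X]
    [MeasurableSpace Y] [MeasurableSpace.CountablySeparated Y] {μ ν : Measure X} (h : μ ⟂ₘ ν)
    {g : X → Y} (hg : Measurable g) {G : Set X} (hG : MeasurableSet G) (hinj : Set.InjOn g G)
    (hμ : μ Gᶜ = 0) (hν : ν Gᶜ = 0) : μ.map g ⟂ₘ ν.map g := by
  obtain ⟨s, hs, hμs, hνs⟩ := h
  have himage : MeasurableSet (g '' (G ∩ s)) :=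
    (hG.inter hs).image_of_measurable_injOn hg (hinj.mono Set.inter_subset_left)
  refine ⟨_, himage, ?_, ?_⟩
  · rw [Measure.map_apply hg himage]
    refine measure_mono_null (fun x hx => ?_) (measure_union_null hμ hμs)
    rw [Set.mem_union, or_iff_not_imp_left, Set.notMem_compl_iff]
    intro hxG
    obtain ⟨y, ⟨hyG, hys⟩, hyx⟩ := hx
    rwa [← hinj hyG hxG hyx]
  · rw [Measure.map_apply hg himage.compl]
    refine measure_mono_null (fun x hx => ?_) (measure_union_null hν hνs)
    rw [Set.mem_union, or_iff_not_imp_left, Set.notMem_compl_iff]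
    exact fun hxG hxs => hx ⟨x, ⟨hxG, hxs⟩, rfl⟩

theorem nullSingletonClass_map_of_countable_fiber {X Y : Type*} [MeasurableSpace X]
    [MeasurableSpace Y] [MeasurableSingletonClass Y] {μ : Measure X} [NullSingletonClass μ]
    {g : X → Y} (hg : Measurable g) (hfib : ∀ y, (g ⁻¹' {y}).Countable) :
    NullSingletonClass (μ.map g) :=
  ⟨fun y => by
    rw [Measure.map_apply hg (measurableSet_singleton y)]
    exact (hfib y).measure_zero μ⟩

theorem countable_preimage_coe_singleton (x : UnitAddCircle) :
    (((↑) : ℝ → UnitAddCircle) ⁻¹' {x}).Countable := by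
  obtain ⟨y, rfl⟩ := QuotientAddGroup.mk_surjective x
  refine (Set.countable_range fun n : ℤ => y + n).mono fun z hz => ?_
  have hzero : ((z - y : ℝ) : UnitAddCircle) = 0 := by
    rw [AddCircle.coe_sub, sub_eq_zero]
    exact hz
  obtain ⟨n, hn⟩ := (AddCircle.coe_eq_zero_iff 1).1 hzero
  exact ⟨n, by rw [zsmul_one] at hn; simp only [hn]; ring⟩

theorem injOn_coe_Ioc : Set.InjOn ((↑) : ℝ → UnitAddCircle) (Set.Ioc 0 1) := by
  intro x hx y hy hxy
  have hsection : ∀ z ∈ Set.Ioc (0 : ℝ) 1, (AddCircle.equivIoc (1 : ℝ) 0 z : ℝ) = z :=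
    fun z hz => AddCircle.equivIoc_coe_of_mem (by rwa [zero_add])
  rw [← hsection x hx, hxy, hsection y hy]

theorem compl_Ioc_of_compl_Icc {μ : Measure ℝ} [NullSingletonClass μ] (h : μ (Set.Icc 0 1)ᶜ = 0) :
    μ (Set.Ioc 0 1)ᶜ = 0 :=
  (measure_congr Ioc_ae_eq_Icc.compl).trans h

theorem isSingularContinuous_map_coe {μ : Measure ℝ} [NullSingletonClass μ]
    (hI : μ (Set.Icc 0 1)ᶜ = 0) (hs : μ ⟂ₘ unitLebesgue) :
    IsSingularContinuous (μ.map ((↑) : ℝ → UnitAddCircle)) := by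
  refine ⟨(nullSingletonClass_map_of_countable_fiber AddCircle.measurable_mk'
    countable_preimage_coe_singleton).measure_singleton, ?_⟩
  rw [← map_coe_unitLebesgue]
  exact mutuallySingular_map_of_injOn hs AddCircle.measurable_mk' measurableSet_Ioc injOn_coe_Ioc
    (compl_Ioc_of_compl_Icc hI) unitLebesgue_compl_Ioc

theorem IsSingularContinuous.of_absolutelyContinuous {μ ν : Measure UnitAddCircle}
    (hν : IsSingularContinuous ν) (h : μ ≪ ν) : IsSingularContinuous μ :=
  ⟨fun x => h (hν.1 x), hν.2.mono_ac h .rfl⟩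

theorem isAbsContinuous_of_absolutelyContinuous {μ : Measure UnitAddCircle} [IsFiniteMeasure μ]
    (h : μ ≪ volume) : IsAbsContinuous μ := by
  refine ⟨fun x => (μ.rnDeriv volume x).toReal, Measure.integrable_toReal_rnDeriv,
    fun x => ENNReal.toReal_nonneg, ?_⟩
  conv_lhs => rw [← Measure.withDensity_rnDeriv_eq μ volume h]
  refine withDensity_congr_ae ?_
  filter_upwards [Measure.rnDeriv_lt_top μ volume] with x hx
  rw [ENNReal.ofReal_toReal hx.ne]

theorem isPurePoint_sum {ι : Type*} [Countable ι] (c : ι → ℝ≥0∞) (x : ι → UnitAddCircle) :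
    IsPurePoint (Measure.sum fun i => c i • Measure.dirac (x i)) := by
  obtain ⟨e, he⟩ := Countable.exists_injective_nat ι
  refine ⟨Function.extend e c 0, Function.extend e x 0, ?_⟩
  rw [← Measure.sum_extend_zero he]
  congr 1
  ext1 n
  by_cases hn : ∃ i, e i = n
  · obtain ⟨i, rfl⟩ := hn
    simp only [he.extend_apply]
  · simp [Function.extend_apply' _ _ _ hn]

theorem isPurePoint_of_countable_carrier {μ : Measure UnitAddCircle} {C : Set UnitAddCircle}
    (hC : C.Countable) (h : μ Cᶜ = 0) : IsPurePoint μ := by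
  have := hC.to_subtype
  have hsum := Measure.restrict_biUnion (μ := μ) (s := fun x : UnitAddCircle => {x}) hC
    (fun _ _ _ _ => Set.disjoint_singleton.2) measurableSet_singleton
  simp only [Set.biUnion_of_singleton, Measure.restrict_singleton] at hsum
  rw [← Measure.restrict_eq_self_of_ae_mem (s := C) h, hsum]
  exact isPurePoint_sum _ _

/-! ### Lebesgue types of the normalised root measure -/

theorem nullSingletonClass_dyadicCopies (β : Measure ℝ) [NullSingletonClass β] :
    NullSingletonClass (dyadicCopies β) := by
  refine ⟨fun x => ?_⟩
  rw [dyadicCopies, Measure.sum_apply_eq_zero]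
  intro w
  rw [(measurableEmbedding_dyadicBranch _ _).map_apply]
  exact (Set.subsingleton_singleton.preimage
    (measurableEmbedding_dyadicBranch _ _).injective).measure_zero β

theorem dyadicCopies_mutuallySingular_unitLebesgue {β : Measure ℝ}
    (hβ : β (Set.Ioc 0 1)ᶜ = 0) (h : β ⟂ₘ unitLebesgue) : dyadicCopies β ⟂ₘ unitLebesgue := by
  have hvol : β ⟂ₘ (volume : Measure ℝ) := by
    rw [← Measure.restrict_add_restrict_compl (μ := volume)
      (measurableSet_Ioc (a := (0 : ℝ)) (b := 1))]
    exact h.add_right ⟨_, measurableSet_Ioc.compl, hβ, by simp⟩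
  refine Measure.MutuallySingular.sum_left.2 fun w => ?_
  have hmap := (measurableEmbedding_dyadicBranch w.1 w.2).mutuallySingular_map hvol
  rw [map_dyadicBranch_volume] at hmap
  exact hmap.mono_ac .rfl (Measure.restrict_le_self.absolutelyContinuous.trans
    (Measure.absolutelyContinuous_smul (by positivity)))

section TorusRootMeasure

variable {α : ℝ≥0∞} {b₀ b₁ : ℕ} {f : ℕ → ℕ}

theorem torusRootMeasure_absolutelyContinuous_map_dyadicCopies (β : Measure ℝ) :
    torusRootMeasure α b₀ b₁ f β ≪ (dyadicCopies β).map ((↑) : ℝ → UnitAddCircle) :=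
  torusRootMeasure_absolutelyContinuous (fun _ => map_dyadicCopies_absolutelyContinuous β)
    (absolutelyContinuous_dyadicCopies β)

theorem torusRootMeasure_unitLebesgue_absolutelyContinuous :
    torusRootMeasure α b₀ b₁ f unitLebesgue ≪ volume := by
  rw [← map_coe_unitLebesgue]
  exact torusRootMeasure_absolutelyContinuous
    (fun _ => map_dyadicBranch_unitLebesgue_absolutelyContinuous) .rfl

theorem isSingularContinuous_torusRootMeasure {β : Measure ℝ} [NullSingletonClass β]
    (hI : β (Set.Icc 0 1)ᶜ = 0) (h : β ⟂ₘ unitLebesgue) :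
    IsSingularContinuous (torusRootMeasure α b₀ b₁ f β) := by
  have := nullSingletonClass_dyadicCopies β
  have hcopies := isSingularContinuous_map_coe (dyadicCopies_compl_Icc hI)
    (dyadicCopies_mutuallySingular_unitLebesgue (compl_Ioc_of_compl_Icc hI) h)
  exact hcopies.of_absolutelyContinuous
    (torusRootMeasure_absolutelyContinuous_map_dyadicCopies β)

theorem isPurePoint_torusRootMeasure_dirac (x : ℝ) :
    IsPurePoint (torusRootMeasure α b₀ b₁ f (Measure.dirac x)) := by
  have hcount := Set.countable_range
    fun w : Σ k, Fin (2 ^ k) => (dyadicBranch w.1 w.2 x : UnitAddCircle)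
  refine isPurePoint_of_countable_carrier hcount
    (torusRootMeasure_absolutelyContinuous_map_dyadicCopies _ ?_)
  rw [Measure.map_apply AddCircle.measurable_mk' hcount.measurableSet.compl, dyadicCopies,
    Measure.sum_apply_eq_zero]
  intro w
  simp [Measure.map_dirac' (measurable_dyadicBranch _ _)]

end TorusRootMeasure

/-! ### Degenerate self-similar measures -/

theorem isBinarySelfSimilar_dirac_zero : IsBinarySelfSimilar 1 0 (Measure.dirac 0) where
  isProbabilityMeasure := inferInstance
  compl_Icc := by simp
  bisect_eq := by simp [bisect, Measure.map_dirac' (measurable_dyadicBranch _ _), dyadicBranch]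

theorem isBinarySelfSimilar_dirac_one : IsBinarySelfSimilar 0 1 (Measure.dirac 1) where
  isProbabilityMeasure := inferInstance
  compl_Icc := by simp
  bisect_eq := by
    have hfix : dyadicBranch 1 1 1 = 1 := by norm_num [dyadicBranch]
    simp [bisect, Measure.map_dirac' (measurable_dyadicBranch _ _), hfix]

/-! ### Bernoulli measures -/

/-- The sequence with first term `x.1` and tail `x.2`, used to split off the leading digit. -/
def consSeq {X : Type*} (x : X × (ℕ → X)) : ℕ → X
  | 0 => x.1
  | n + 1 => x.2 n

theorem measurable_consSeq {X : Type*} [MeasurableSpace X] :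
    Measurable (consSeq : X × (ℕ → X) → ℕ → X) := by
  refine measurable_pi_iff.2 fun n => ?_
  cases n with
  | zero => exact measurable_fst
  | succ n => exact (measurable_pi_apply n).comp measurable_snd

theorem consSeq_preimage_pi_range {X : Type*} (N : ℕ) (t : ℕ → Set X) :
    consSeq ⁻¹' Set.pi (Finset.range (N + 1)) t =
      t 0 ×ˢ Set.pi (Finset.range N) fun n => t (n + 1) := by
  ext x
  simp only [Finset.coe_range, Set.mem_preimage, Set.mem_pi, Set.mem_Iio, Set.mem_prod]
  refine ⟨fun h => ⟨h 0 N.succ_pos, fun n hn => h (n + 1) (Nat.succ_lt_succ hn)⟩, ?_⟩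
  rintro ⟨h0, h1⟩ (_ | n) hn
  · exact h0
  · exact h1 n (Nat.succ_lt_succ_iff.1 hn)

theorem map_consSeq_infinitePi {X : Type*} [MeasurableSpace X] (ν : Measure X)
    [IsProbabilityMeasure ν] :
    (ν.prod (Measure.infinitePi fun _ : ℕ => ν)).map consSeq =
      Measure.infinitePi fun _ : ℕ => ν := by
  classical
  refine Measure.eq_infinitePi _ fun s t ht => ?_
  obtain ⟨N, hN⟩ := s.exists_nat_subset_range
  have hs : s ⊆ Finset.range (N + 1) := hN.trans (Finset.range_mono N.le_succ)
  let u : ℕ → Set X := fun n => if n ∈ s then t n else Set.univ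
  have hu : ∀ n, MeasurableSet (u n) := fun n => by
    dsimp only [u]
    split_ifs
    exacts [ht n, .univ]
  have hpi : Set.pi (s : Set ℕ) t = Set.pi (Finset.range (N + 1) : Set ℕ) u := by
    ext x
    simp only [Set.mem_pi, u]
    refine ⟨fun h n _ => ?_, fun h n hn => by simpa [Finset.mem_coe.1 hn] using h n (hs hn)⟩
    split_ifs with hn
    exacts [h n hn, trivial]
  rw [hpi, Measure.map_apply measurable_consSeq (.pi (Finset.countable_toSet _) fun n _ => hu n),
    consSeq_preimage_pi_range, Measure.prod_prod, Measure.infinitePi_pi _ fun n _ => hu (n + 1),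
    mul_comm, ← Finset.prod_range_succ' fun n => ν (u n)]
  refine (Finset.prod_subset hs fun n _ hn => ?_).symm.trans (Finset.prod_congr rfl fun n hn => ?_)
  · simp [u, hn]
  · simp [u, hn]

/-- The law of a bit that is `0` with probability `p` and `1` with probability `q`. -/
noncomputable def bitMeasure (p q : ℝ≥0∞) : Measure (Fin 2) :=
  p • Measure.dirac 0 + q • Measure.dirac 1

/-- The law of a sequence of independent bits with law `bitMeasure p q`. -/
noncomputable def bitSequenceMeasure (p q : ℝ≥0∞) : Measure (ℕ → Fin 2) :=
  Measure.infinitePi fun _ => bitMeasure p q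

/-- The law of a random number in the unit interval whose binary digits are independent with law
`bitMeasure p q`. -/
noncomputable def bernoulliMeasure (p q : ℝ≥0∞) : Measure ℝ :=
  (bitSequenceMeasure p q).map Real.ofDigits

theorem measurable_ofDigits_two : Measurable (Real.ofDigits : (ℕ → Fin 2) → ℝ) :=
  Real.continuous_ofDigits.measurable

theorem ofDigits_eq_dyadicBranch (ω : ℕ → Fin 2) :
    Real.ofDigits ω = dyadicBranch 1 (ω 0 : ℕ) (Real.ofDigits fun i => ω (i + 1)) := by
  rw [Real.ofDigits_eq_sum_add_ofDigits ω 1, dyadicBranch]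
  simp only [Finset.sum_range_one, Real.ofDigitsTerm]
  push_cast
  ring

section Bernoulli

variable {p q : ℝ≥0∞}

theorem isProbabilityMeasure_bitMeasure (h : p + q = 1) : IsProbabilityMeasure (bitMeasure p q) :=
  ⟨by simp [bitMeasure, h]⟩

theorem isProbabilityMeasure_bitSequenceMeasure (h : p + q = 1) :
    IsProbabilityMeasure (bitSequenceMeasure p q) := by
  have := isProbabilityMeasure_bitMeasure h
  unfold bitSequenceMeasure
  infer_instance

theorem map_consSeq_bitSequenceMeasure (h : p + q = 1) :
    ((bitMeasure p q).prod (bitSequenceMeasure p q)).map consSeq = bitSequenceMeasure p q :=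
  have := isProbabilityMeasure_bitMeasure h
  map_consSeq_infinitePi _

theorem bitMeasure_prod (ν : Measure (ℕ → Fin 2)) [SFinite ν] :
    (bitMeasure p q).prod ν = p • ν.map (Prod.mk 0) + q • ν.map (Prod.mk 1) := by
  simp only [bitMeasure, Measure.add_prod, Measure.prod_smul_left, Measure.dirac_prod]

theorem bisect_bernoulliMeasure (h : p + q = 1) :
    bisect p q (bernoulliMeasure p q) = bernoulliMeasure p q := by
  have := isProbabilityMeasure_bitSequenceMeasure h
  have hbranch : ∀ d : Fin 2, ((bitSequenceMeasure p q).map (Prod.mk d)).map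
      (Real.ofDigits ∘ consSeq) = (bernoulliMeasure p q).map (dyadicBranch 1 d) := fun d => by
    rw [bernoulliMeasure, Measure.map_map (measurable_ofDigits_two.comp measurable_consSeq)
      measurable_prodMk_left, Measure.map_map (measurable_dyadicBranch _ _) measurable_ofDigits_two]
    congr 1
    ext ω
    exact ofDigits_eq_dyadicBranch _
  symm
  calc bernoulliMeasure p q
      = ((bitMeasure p q).prod (bitSequenceMeasure p q)).map (Real.ofDigits ∘ consSeq) := by
        rw [← Measure.map_map measurable_ofDigits_two measurable_consSeq,
          map_consSeq_bitSequenceMeasure h, bernoulliMeasure]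
    _ = bisect p q (bernoulliMeasure p q) := by
        rw [bitMeasure_prod, Measure.map_add _ _ (measurable_ofDigits_two.comp measurable_consSeq),
          Measure.map_smul, Measure.map_smul, hbranch, hbranch]
        rfl

theorem isBinarySelfSimilar_bernoulliMeasure (h : p + q = 1) :
    IsBinarySelfSimilar p q (bernoulliMeasure p q) where
  isProbabilityMeasure :=
    have := isProbabilityMeasure_bitSequenceMeasure h
    Measure.isProbabilityMeasure_map measurable_ofDigits_two.aemeasurable
  compl_Icc := by
    rw [bernoulliMeasure, Measure.map_apply measurable_ofDigits_two measurableSet_Icc.compl]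
    simp [Set.preimage, Real.ofDigits_nonneg, Real.ofDigits_le_one]
  bisect_eq := bisect_bernoulliMeasure h

theorem measurePreserving_shift (h : p + q = 1) (j : ℕ) :
    MeasurePreserving (fun (ω : ℕ → Fin 2) i => ω (i + j)) (bitSequenceMeasure p q)
      (bitSequenceMeasure p q) := by
  have := isProbabilityMeasure_bitMeasure h
  have := isProbabilityMeasure_bitSequenceMeasure h
  have hone : MeasurePreserving (fun (ω : ℕ → Fin 2) i => ω (i + 1)) (bitSequenceMeasure p q)
      (bitSequenceMeasure p q) := by
    refine ⟨by fun_prop, ?_⟩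
    conv_lhs => rw [← map_consSeq_bitSequenceMeasure h,
      Measure.map_map (by fun_prop) measurable_consSeq]
    exact measurePreserving_snd.map_eq
  induction j with
  | zero => exact .id _
  | succ j ih => exact ih.comp hone

theorem bernoulliMeasure_inv_two : bernoulliMeasure 2⁻¹ 2⁻¹ = unitLebesgue := by
  have hβ := isBinarySelfSimilar_bernoulliMeasure ENNReal.inv_two_add_inv_two
  have := hβ.isProbabilityMeasure
  exact hβ.isDyadicFamily_const.ext isBinarySelfSimilar_unitLebesgue.isDyadicFamily_const (by simp)

end Bernoulli

/-! ### Atoms of self-similar measures -/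

theorem eq_zero_of_le_mul_of_lt_one {a r : ℝ≥0∞} (hr : r < 1) (ha : a ≠ ∞) (h : a ≤ r * a) :
    a = 0 := by
  by_contra h0
  have hlt : r * a < 1 * a := ENNReal.mul_lt_mul_left h0 ha hr
  exact absurd h (by rwa [one_mul, ← not_le] at hlt)

namespace IsBinarySelfSimilar

variable {p q : ℝ≥0∞} {β : Measure ℝ}

theorem apply_singleton (hβ : IsBinarySelfSimilar p q β) (x : ℝ) :
    β {x} = p * β {2 * x} + q * β {2 * x - 1} := by
  have hleft : dyadicBranch 1 0 ⁻¹' {x} = {2 * x} := by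
    ext y
    simp only [dyadicBranch, Set.mem_preimage, Set.mem_singleton_iff]
    grind
  have hright : dyadicBranch 1 1 ⁻¹' {x} = {2 * x - 1} := by
    ext y
    simp only [dyadicBranch, Set.mem_preimage, Set.mem_singleton_iff]
    grind
  conv_lhs => rw [← hβ.bisect_eq]
  rw [bisect_apply _ _ _ (measurableSet_singleton x), hleft, hright]

theorem apply_singleton_of_notMem (hβ : IsBinarySelfSimilar p q β) {x : ℝ}
    (hx : x ∉ Set.Icc (0 : ℝ) 1) : β {x} = 0 :=
  measure_mono_null (by simpa using hx) hβ.compl_Icc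

theorem apply_singleton_of_nonpos (hβ : IsBinarySelfSimilar p q β) (hp : p < 1) {x : ℝ}
    (hx : x ≤ 0) : β {x} = 0 := by
  have := hβ.isProbabilityMeasure
  rcases hx.lt_or_eq with hx | rfl
  · exact hβ.apply_singleton_of_notMem fun h => hx.not_ge h.1
  · refine eq_zero_of_le_mul_of_lt_one hp (measure_ne_top _ _) ?_
    conv_lhs => rw [hβ.apply_singleton, hβ.apply_singleton_of_notMem (x := 2 * 0 - 1) (by norm_num),
      mul_zero, mul_zero, add_zero]

theorem nullSingletonClass (hβ : IsBinarySelfSimilar p q β) (hp : p < 1) (hq : q < 1) :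
    NullSingletonClass β := by
  have := hβ.isProbabilityMeasure
  have hle : ∀ x, β {x} ≤ max p q * ⨆ y, β {y} := fun x => by
    rw [hβ.apply_singleton x]
    rcases le_or_gt x (1 / 2) with hx | hx
    · rw [hβ.apply_singleton_of_nonpos hp (x := 2 * x - 1) (by linarith), mul_zero, add_zero]
      exact mul_le_mul' (le_max_left p q) (le_iSup (fun y => β {y}) _)
    · rw [hβ.apply_singleton_of_notMem (x := 2 * x) fun h => by linarith [h.2], mul_zero, zero_add]
      exact mul_le_mul' (le_max_right p q) (le_iSup (fun y => β {y}) _)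
  have hsup : ⨆ y, β {y} = 0 :=
    eq_zero_of_le_mul_of_lt_one (max_lt hp hq)
      ((iSup_le fun _ => prob_le_one).trans_lt ENNReal.one_lt_top).ne (iSup_le hle)
  exact ⟨ENNReal.iSup_eq_zero.1 hsup⟩

end IsBinarySelfSimilar

/-! ### Singularity of biased Bernoulli measures -/

section Singularity

variable {p q p' q' : ℝ≥0∞}

theorem integral_bitMeasure (h : p + q = 1) : ∫ d : Fin 2, (d : ℝ) ∂bitMeasure p q = q.toReal := by
  have hp : p ≠ ∞ := fun hp => by simp [hp] at h
  have hq : q ≠ ∞ := fun hq => by simp [hq] at h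
  rw [bitMeasure, integral_add_measure (Integrable.of_finite.smul_measure hp)
    (Integrable.of_finite.smul_measure hq)]
  simp

theorem ae_tendsto_average_bits (h : p + q = 1) :
    ∀ᵐ ω ∂(bitSequenceMeasure p q), Tendsto
      (fun n : ℕ => (∑ i ∈ Finset.range n, (ω i : ℝ)) / n) atTop (𝓝 q.toReal) := by
  have := isProbabilityMeasure_bitMeasure h
  have := isProbabilityMeasure_bitSequenceMeasure h
  have hval : Measurable fun d : Fin 2 => (d : ℝ) := measurable_of_finite _
  have heval : ∀ i, MeasurePreserving (Function.eval i) (bitSequenceMeasure p q)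
      (bitMeasure p q) := measurePreserving_eval_infinitePi fun _ => bitMeasure p q
  have hident : ∀ i, ProbabilityTheory.IdentDistrib (fun ω : ℕ → Fin 2 => ω i) (fun ω => ω 0)
      (bitSequenceMeasure p q) (bitSequenceMeasure p q) := fun i =>
    ⟨(heval i).aemeasurable, (heval 0).aemeasurable, (heval i).map_eq.trans (heval 0).map_eq.symm⟩
  have hindep := ProbabilityTheory.iIndepFun_infinitePi (P := fun _ : ℕ => bitMeasure p q)
    (X := fun _ d => (d : ℝ)) fun _ => hval
  have hmean : ∫ ω : ℕ → Fin 2, (ω 0 : ℝ) ∂bitSequenceMeasure p q = q.toReal := by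
    rw [← integral_bitMeasure h, ← (heval 0).map_eq,
      integral_map (heval 0).aemeasurable hval.aestronglyMeasurable]
  have hint : Integrable (fun ω : ℕ → Fin 2 => (ω 0 : ℝ)) (bitSequenceMeasure p q) :=
    (heval 0).integrable_comp_of_integrable (g := fun d : Fin 2 => (d : ℝ)) .of_finite
  rw [← hmean]
  exact ProbabilityTheory.strong_law_ae_real (fun i (ω : ℕ → Fin 2) => (ω i : ℝ)) hint
    (fun i j hij => hindep.indepFun hij) fun i => (hident i).comp hval

theorem bitSequenceMeasure_mutuallySingular (h : p + q = 1) (h' : p' + q' = 1) (hne : q ≠ q') :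
    bitSequenceMeasure p q ⟂ₘ bitSequenceMeasure p' q' := by
  have hlim : q.toReal ≠ q'.toReal := fun heq => hne <| by
    rwa [ENNReal.toReal_eq_toReal_iff'] at heq
    · rintro rfl
      simp at h
    · rintro rfl
      simp at h'
  have hmeas : MeasurableSet {ω : ℕ → Fin 2 | Tendsto
      (fun n : ℕ => (∑ i ∈ Finset.range n, (ω i : ℝ)) / n) atTop (𝓝 q.toReal)} :=
    measurableSet_tendsto _ fun n => by fun_prop
  refine ⟨_, hmeas.compl, ae_tendsto_average_bits h, ?_⟩
  rw [compl_compl]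
  refine measure_eq_zero_iff_ae_notMem.2 ?_
  filter_upwards [ae_tendsto_average_bits h'] with ω hω hω'
  exact hlim (tendsto_nhds_unique hω' hω)

/-- The bit sequences none of whose tails is constantly `1`, a set on which the binary expansion
is injective. -/
def properBitSequences : Set (ℕ → Fin 2) := {ω | ∀ j, Real.ofDigits (fun i => ω (i + j)) ≠ 1}

theorem measurableSet_properBitSequences : MeasurableSet properBitSequences := by
  have htail : ∀ j, Measurable fun ω : ℕ → Fin 2 => Real.ofDigits fun i => ω (i + j) :=
    fun j => measurable_ofDigits_two.comp (by fun_prop)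
  simp only [properBitSequences, Set.ofPred_forall]
  exact .iInter fun j => htail j (measurableSet_singleton 1).compl

theorem bitSequenceMeasure_compl_properBitSequences (h : p + q = 1) (hp : p < 1) (hq : q < 1) :
    bitSequenceMeasure p q properBitSequencesᶜ = 0 := by
  have hone : ∀ᵐ ω ∂bitSequenceMeasure p q, Real.ofDigits ω ≠ 1 := by
    have := (isBinarySelfSimilar_bernoulliMeasure h).nullSingletonClass hp hq
    exact ae_of_ae_map measurable_ofDigits_two.aemeasurable (Measure.ae_ne (bernoulliMeasure p q) 1)
  exact ae_all_iff.2 fun j => (measurePreserving_shift h j).quasiMeasurePreserving.ae hone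

theorem shift_mem_properBitSequences {ω : ℕ → Fin 2} (hω : ω ∈ properBitSequences) :
    (fun i => ω (i + 1)) ∈ properBitSequences :=
  fun j => hω (j + 1)

theorem injOn_ofDigits : Set.InjOn Real.ofDigits properBitSequences := by
  have hhead : ∀ ω ∈ properBitSequences, (ω 0 : ℕ) = ⌊2 * Real.ofDigits ω⌋₊ := fun ω hω => by
    have hlt := (Real.ofDigits_le_one fun i => ω (i + 1)).lt_of_ne (hω 1)
    have h0 := Real.ofDigits_nonneg fun i => ω (i + 1)
    rw [ofDigits_eq_dyadicBranch, dyadicBranch, pow_one, mul_div_cancel₀ _ two_ne_zero,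
      Nat.floor_add_natCast h0, Nat.floor_eq_zero.2 hlt, zero_add]
  intro ω hω ω' hω' heq
  funext i
  induction i generalizing ω ω' with
  | zero => exact Fin.ext (by rw [hhead ω hω, heq, hhead ω' hω'])
  | succ _ ih =>
    refine ih (shift_mem_properBitSequences hω) (shift_mem_properBitSequences hω') ?_
    have h0 : (ω 0 : ℕ) = ω' 0 := by rw [hhead ω hω, heq, hhead ω' hω']
    rw [ofDigits_eq_dyadicBranch, ofDigits_eq_dyadicBranch ω', h0] at heq
    exact (measurableEmbedding_dyadicBranch _ _).injective heq

theorem bernoulliMeasure_mutuallySingular (h : p + q = 1) (h' : p' + q' = 1) (hp : p < 1)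
    (hq : q < 1) (hp' : p' < 1) (hq' : q' < 1) (hne : q ≠ q') :
    bernoulliMeasure p q ⟂ₘ bernoulliMeasure p' q' :=
  mutuallySingular_map_of_injOn (bitSequenceMeasure_mutuallySingular h h' hne)
    measurable_ofDigits_two measurableSet_properBitSequences injOn_ofDigits
    (bitSequenceMeasure_compl_properBitSequences h hp hq)
    (bitSequenceMeasure_compl_properBitSequences h' hp' hq')

theorem bernoulliMeasure_mutuallySingular_unitLebesgue (h : p + q = 1) (hp : p < 1) (hq : q < 1)
    (hpq : p ≠ q) : bernoulliMeasure p q ⟂ₘ unitLebesgue := by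
  rw [← bernoulliMeasure_inv_two]
  refine bernoulliMeasure_mutuallySingular h ENNReal.inv_two_add_inv_two hp hq (by simp)
    (by simp) ?_
  rintro rfl
  rw [← ENNReal.inv_two_add_inv_two] at h
  exact hpq ((ENNReal.add_left_inj (by simp)).1 h)

end Singularity

/-! ### The four regimes -/

section SelfSimilar

variable {A₀ A₁ : ℕ}

theorem exists_isBinarySelfSimilar_unitLebesgue {A : ℕ} (hA : A ≠ 0) :
    ∃ α : ℝ≥0∞, IsBinarySelfSimilar (α * A) (α * A) unitLebesgue := by
  have hhalf : 2⁻¹ * (A : ℝ≥0∞)⁻¹ * A = 2⁻¹ := by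
    rw [mul_assoc, ENNReal.inv_mul_cancel (by exact_mod_cast hA) (ENNReal.natCast_ne_top A),
      mul_one]
  exact ⟨2⁻¹ * (A : ℝ≥0∞)⁻¹, by rw [hhalf]; exact isBinarySelfSimilar_unitLebesgue⟩

theorem exists_isBinarySelfSimilar_dirac (hA : A₀ + A₁ ≠ 0) (h0 : A₀ = 0 ∨ A₁ = 0) :
    ∃ (α : ℝ≥0∞) (x : ℝ), (x : UnitAddCircle) = 0 ∧
      IsBinarySelfSimilar (α * A₀) (α * A₁) (Measure.dirac x) := by
  have hinv : ∀ A : ℕ, A ≠ 0 → (A : ℝ≥0∞)⁻¹ * A = 1 := fun A hA =>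
    ENNReal.inv_mul_cancel (by exact_mod_cast hA) (ENNReal.natCast_ne_top A)
  rcases h0 with rfl | rfl
  · refine ⟨(A₁ : ℝ≥0∞)⁻¹, 1, AddCircle.coe_period 1, ?_⟩
    rw [Nat.cast_zero, mul_zero, hinv _ (by omega)]
    exact isBinarySelfSimilar_dirac_one
  · refine ⟨(A₀ : ℝ≥0∞)⁻¹, 0, rfl, ?_⟩
    rw [Nat.cast_zero, mul_zero, hinv _ (by omega)]
    exact isBinarySelfSimilar_dirac_zero

theorem exists_isBinarySelfSimilar_mutuallySingular (h0 : A₀ ≠ 0) (h1 : A₁ ≠ 0) (hne : A₀ ≠ A₁) :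
    ∃ (α : ℝ≥0∞) (β : Measure ℝ), IsBinarySelfSimilar (α * A₀) (α * A₁) β ∧
      NullSingletonClass β ∧ β ⟂ₘ unitLebesgue := by
  have hA0 : ((A₀ + A₁ : ℕ) : ℝ≥0∞) ≠ 0 := by exact_mod_cast (by omega : A₀ + A₁ ≠ 0)
  have hAtop := ENNReal.natCast_ne_top (A₀ + A₁)
  set α := ((A₀ + A₁ : ℕ) : ℝ≥0∞)⁻¹
  have hsum : α * A₀ + α * A₁ = 1 := by
    rw [← mul_add, ← Nat.cast_add, ENNReal.inv_mul_cancel hA0 hAtop]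
  have hlt : ∀ a < A₀ + A₁, α * a < 1 := fun a ha => by
    rw [mul_comm, ← div_eq_mul_inv, ENNReal.div_lt_iff (.inl hA0) (.inl hAtop), one_mul]
    exact_mod_cast ha
  have hp := hlt A₀ (by omega)
  have hq := hlt A₁ (by omega)
  have hpq : α * A₀ ≠ α * A₁ := fun h => hne <| by
    exact_mod_cast (ENNReal.mul_right_inj (ENNReal.inv_ne_zero.2 hAtop)
      (ENNReal.inv_ne_top.2 hA0)).1 h
  have hβ := isBinarySelfSimilar_bernoulliMeasure hsum
  exact ⟨α, _, hβ, hβ.nullSingletonClass hp hq,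
    bernoulliMeasure_mutuallySingular_unitLebesgue hsum hp hq hpq⟩

end SelfSimilar

namespace IsAffineTwoRegular

variable {A₀ A₁ b₀ b₁ : ℕ} {f : ℕ → ℕ}

theorem apply_one_ne_zero_or (hf : IsAffineTwoRegular A₀ A₁ b₀ b₁ f)
    (hf0 : ∃ n : ℕ, 1 ≤ n ∧ f n ≠ 0) : f 1 ≠ 0 ∨ b₀ + b₁ ≠ 0 := by
  by_contra! h
  obtain ⟨n, hn, hfn⟩ := hf0
  obtain ⟨h1, hb⟩ := h
  obtain ⟨rfl, rfl⟩ := Nat.add_eq_zero_iff.1 hb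
  exact hfn (hf.eq_zero_of_apply_one_eq_zero h1 hn)

theorem exists_isGhostMeasure_isAbsContinuous {A : ℕ} (hf : IsAffineTwoRegular A A b₀ b₁ f)
    (hA : A ≠ 0) (hbA : b₀ + b₁ = 0 ∨ 2 < A + A) (hne : f 1 ≠ 0 ∨ b₀ + b₁ ≠ 0) :
    ∃ μ, IsGhostMeasure f μ ∧ IsProbabilityMeasure μ ∧ IsAbsContinuous μ ∧
      (b₀ + b₁ = 0 → μ = volume) := by
  obtain ⟨α, hβ⟩ := exists_isBinarySelfSimilar_unitLebesgue hA
  obtain ⟨hμ, hprob⟩ := hf.isGhostMeasure_torusRootMeasure hβ hbA hne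
  refine ⟨_, hμ, hprob, isAbsContinuous_of_absolutelyContinuous
    torusRootMeasure_unitLebesgue_absolutelyContinuous, fun hb => ?_⟩
  have hf1 := hne.resolve_right (not_not.2 hb)
  obtain ⟨rfl, rfl⟩ := Nat.add_eq_zero_iff.1 hb
  rw [torusRootMeasure_of_homogeneous hf1, map_coe_unitLebesgue]

theorem exists_isGhostMeasure_isPurePoint (hf : IsAffineTwoRegular A₀ A₁ b₀ b₁ f)
    (hA : A₀ + A₁ ≠ 0) (h0 : A₀ = 0 ∨ A₁ = 0) (hbA : b₀ + b₁ = 0 ∨ 2 < A₀ + A₁)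
    (hne : f 1 ≠ 0 ∨ b₀ + b₁ ≠ 0) :
    ∃ μ, IsGhostMeasure f μ ∧ IsProbabilityMeasure μ ∧ IsPurePoint μ ∧
      (b₀ + b₁ = 0 → μ = Measure.dirac 0) := by
  obtain ⟨α, x, hx, hβ⟩ := exists_isBinarySelfSimilar_dirac hA h0
  obtain ⟨hμ, hprob⟩ := hf.isGhostMeasure_torusRootMeasure hβ hbA hne
  refine ⟨_, hμ, hprob, isPurePoint_torusRootMeasure_dirac x, fun hb => ?_⟩
  have hf1 := hne.resolve_right (not_not.2 hb)
  obtain ⟨rfl, rfl⟩ := Nat.add_eq_zero_iff.1 hb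
  rw [torusRootMeasure_of_homogeneous hf1, Measure.map_dirac' AddCircle.measurable_mk', hx]

theorem exists_isGhostMeasure_isSingularContinuous (hf : IsAffineTwoRegular A₀ A₁ b₀ b₁ f)
    (h0 : A₀ ≠ 0) (h1 : A₁ ≠ 0) (hA : A₀ ≠ A₁) (hbA : b₀ + b₁ = 0 ∨ 2 < A₀ + A₁)
    (hne : f 1 ≠ 0 ∨ b₀ + b₁ ≠ 0) :
    ∃ μ, IsGhostMeasure f μ ∧ IsProbabilityMeasure μ ∧ IsSingularContinuous μ := by
  obtain ⟨α, β, hβ, hatom, hsing⟩ := exists_isBinarySelfSimilar_mutuallySingular h0 h1 hA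
  obtain ⟨hμ, hprob⟩ := hf.isGhostMeasure_torusRootMeasure hβ hbA hne
  exact ⟨_, hμ, hprob, isSingularContinuous_torusRootMeasure hβ.compl_Icc hsing⟩

end IsAffineTwoRegular

theorem theorem1 (A₀ A₁ b₀ b₁ : ℕ) (hcoeff : ¬ (A₀ = 0 ∧ A₁ = 0 ∧ b₀ = 0 ∧ b₁ = 0))
    (f : ℕ → ℕ) (hf : IsAffineTwoRegular A₀ A₁ b₀ b₁ f) (hf0 : ∃ n : ℕ, 1 ≤ n ∧ f n ≠ 0) :
    ∃ μ : Measure UnitAddCircle,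
      IsGhostMeasure f μ ∧ (∀ ν : Measure UnitAddCircle, IsGhostMeasure f ν → ν = μ) ∧
      IsProbabilityMeasure μ ∧
      -- homogeneous case
      (b₀ = 0 ∧ b₁ = 0 →
        (A₀ = A₁ ∧ A₀ ≠ 0 → μ = volume) ∧
        (A₀ ≠ A₁ ∧ A₀ ≠ 0 ∧ A₁ ≠ 0 → IsSingularContinuous μ) ∧
        (A₀ = 0 ∨ A₁ = 0 → IsPurePoint μ ∧ μ = Measure.dirac 0)) ∧
      -- inhomogeneous case
      (b₀ + b₁ ≠ 0 →
        (A₀ + A₁ ≤ 2 → μ = volume) ∧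
        (A₀ = A₁ ∧ 1 < A₀ → IsAbsContinuous μ) ∧
        (A₀ ≠ A₁ ∧ A₀ ≠ 0 ∧ A₁ ≠ 0 → IsSingularContinuous μ) ∧
        ((A₀ = 0 ∧ 2 < A₁) ∨ (A₁ = 0 ∧ 2 < A₀) → IsPurePoint μ)) := by
  have hne := hf.apply_one_ne_zero_or hf0
  by_cases hsmall : b₀ + b₁ ≠ 0 ∧ A₀ + A₁ ≤ 2
  · have hμ := hf.isGhostMeasure_volume hsmall.1 hsmall.2
    refine ⟨volume, hμ, fun _ => hμ.unique, ⟨by simp⟩, ?_⟩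
    grind
  have hbA : b₀ + b₁ = 0 ∨ 2 < A₀ + A₁ := by omega
  by_cases heq : A₀ = A₁
  · subst heq
    obtain ⟨μ, hμ, hprob, hac, hvol⟩ :=
      hf.exists_isGhostMeasure_isAbsContinuous (by omega) hbA hne
    refine ⟨μ, hμ, fun _ => hμ.unique, hprob, ?_⟩
    grind
  by_cases hzero : A₀ = 0 ∨ A₁ = 0
  · obtain ⟨μ, hμ, hprob, hpp, hdirac⟩ :=
      hf.exists_isGhostMeasure_isPurePoint (by omega) hzero hbA hne
    refine ⟨μ, hμ, fun _ => hμ.unique, hprob, ?_⟩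
    grind
  · obtain ⟨μ, hμ, hprob, hsc⟩ := hf.exists_isGhostMeasure_isSingularContinuous
      (by omega) (by omega) heq hbA hne
    refine ⟨μ, hμ, fun _ => hμ.unique, hprob, ?_⟩
    grind
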